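/- Let $d\in\mathbb N$, let $\mathcal D$ be a probability distribution, and let $F(x;\zeta)$, $x\in\mathbb R^d$, be real functions that are differentiable in $x$ and, for every $x$, measurable and $\mathcal D$-integrable in $\zeta$. Put $f(x)=\mathbb E_{\zeta\sim\mathcal D}F(x;\zeta)$ and let gradients be taken in $x$. Let $L,\rho,\sigma>0$ and assume, with $\|\cdot\|$ the Euclidean (for matrices the spectral) norm: * $\|\nabla F(x;\zeta)-\nabla F(x';\zeta)\|\le L\|x-x'\|$ for all $x,x',\zeta$; $f$ is twice continuously differentiable and $\|\nabla^2 f(x)-\nabla^2 f(x')\|\le\rho\|x-x'\|$ for all $x,x'$; * for every $x$, $\|\nabla F(x;\zeta)-\nabla f(x)\|^2\le\sigma^2$ for $\mathcal D$-almost every $\zeta$. Let $\varepsilon>0$, $p\in(0,1)$, $\eta>0$ and set $$\tilde C_1=2\left\lfloor\frac{\log(3p^{-1})}{\log(0.7^{-1})}+1\right\rfloor\log\frac{24\sqrt d}{\eta},\quad \delta=\sqrt{\rho\varepsilon},\quad \delta_2=16\delta,\quad B=\frac{\delta}{\rho\tilde C_1},\quad K_0=\tilde C_1\eta^{-1}\delta_2^{-1}.$$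 Assume $$\eta\le\frac{B^2\delta}{64\max(\sigma^2,1)\,\tilde C_1\log(48K_0/p)}\cdot\frac1{3+\log K_0},\qquad B\le\min\Bigl(1,\frac{\sigma}{L},\frac1L\Bigr),\qquad \delta\le1,\qquad K_0\ge1 .$$ Let $\zeta^1,\zeta^2,\dots$ be i.i.d. with law $\mathcal D$, let $x^0$ be a (deterministic or random) starting point independent of $(\zeta^k)_{k\ge1}$, let $x^{k+1}=x^k-\eta\nabla F(x^k;\zeta^{k+1})$ for $k\ge0$, and let $\mathcal K_0=\inf\{k\ge0:\|x^k-x^0\|>B\}$. Then with probability at least $1-\frac23p$ the following holds: if the iterates leave $\{y:\|y-x^0\|\le B\}$ within $K_0$ iterations (that is, $\mathcal K_0\le\lceil K_0\rceil$), then $$f(x^{\mathcal K_0})\le f(x^0)-\frac{B^2}{7\eta K_0}.$$ Moreover the guaranteed decrease is of order $\varepsilon^{1.5}$ up to the logarithmic factor $\tilde C_1$: $\ \dfrac{B^2}{7\eta K_0}=\dfrac{16}{7}\cdot\dfrac{\varepsilon^{3/2}}{\sqrt\rho\,\tilde C_1^{3}}.$ -/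

import Mathlib

open MeasureTheory ProbabilityTheory

noncomputable section

/-- The objective `f(x) = E_{ζ ∼ D} F(x; ζ)`. -/
def objective {d : ℕ} {Z : Type*} [MeasurableSpace Z]
    (F : EuclideanSpace ℝ (Fin d) → Z → ℝ) (D : Measure Z)
    (x : EuclideanSpace ℝ (Fin d)) : ℝ :=
  ∫ z, F x z ∂D

/-- The stochastic gradient `∇F(x; z)`, the gradient being taken in `x`. -/
def stochGrad {d : ℕ} {Z : Type*}
    (F : EuclideanSpace ℝ (Fin d) → Z → ℝ)
    (x : EuclideanSpace ℝ (Fin d)) (z : Z) : EuclideanSpace ℝ (Fin d) :=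
  gradient (fun y => F y z) x

/-- The Hessian `∇²f(x)` as a linear operator; its norm is the spectral norm. -/
def hessian {d : ℕ} (f : EuclideanSpace ℝ (Fin d) → ℝ)
    (x : EuclideanSpace ℝ (Fin d)) :
    EuclideanSpace ℝ (Fin d) →L[ℝ] EuclideanSpace ℝ (Fin d) :=
  fderiv ℝ (gradient f) x

/-- The SGD iterates `x^{k+1} = x^k - η ∇F(x^k; ζ^{k+1})` of one round started at `x0`.
The sample `ζ^{k+1}` is `z k`. -/
def sgdIterate {d : ℕ} {Z : Type*}
    (F : EuclideanSpace ℝ (Fin d) → Z → ℝ) (η : ℝ)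
    (x0 : EuclideanSpace ℝ (Fin d)) (z : ℕ → Z) : ℕ → EuclideanSpace ℝ (Fin d)
  | 0 => x0
  | k + 1 => sgdIterate F η x0 z k - η • stochGrad F (sgdIterate F η x0 z k) (z k)

/-- The first index `k` with `‖x^k - x^0‖ > B`. It is only used when such an index exists. -/
def exitTime {d : ℕ} (x : ℕ → EuclideanSpace ℝ (Fin d)) (B : ℝ) : ℕ :=
  sInf {k : ℕ | B < ‖x k - x 0‖}

/-- `C̃₁ = 2 ⌊log(3/p) / log(0.7⁻¹) + 1⌋ log(24 √d / η)`. -/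
def paramC (d : ℕ) (p η : ℝ) : ℝ :=
  2 * (⌊Real.log (3 * p⁻¹) / Real.log ((0.7 : ℝ)⁻¹) + 1⌋ : ℝ) * Real.log (24 * √(d : ℝ) / η)

/-- `δ = √(ρ ε)`. -/
def paramDelta (ρ ε : ℝ) : ℝ := √(ρ * ε)

/-- `δ₂ = 16 δ`. -/
def paramDelta₂ (ρ ε : ℝ) : ℝ := 16 * paramDelta ρ ε

/-- `B = δ / (ρ C̃₁)`. -/
def paramB (d : ℕ) (ρ ε p η : ℝ) : ℝ := paramDelta ρ ε / (ρ * paramC d p η)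

/-- `K₀ = C̃₁ η⁻¹ δ₂⁻¹` (a real number). -/
def paramK (d : ℕ) (ρ ε p η : ℝ) : ℝ := paramC d p η * η⁻¹ * (paramDelta₂ ρ ε)⁻¹

/-- The parameter setting. -/
structure ParameterSetting (d : ℕ) (L ρ σ ε p η : ℝ) : Prop where
  L_pos : 0 < L
  rho_pos : 0 < ρ
  sigma_pos : 0 < σ
  eps_pos : 0 < ε
  p_pos : 0 < p
  p_lt_one : p < 1
  eta_pos : 0 < η
  eta_le : η ≤ (paramB d ρ ε p η ^ 2 * paramDelta ρ ε) /
      (64 * max (σ ^ 2) 1 * paramC d p η * Real.log (48 * paramK d ρ ε p η / p)) *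
      (1 / (3 + Real.log (paramK d ρ ε p η)))
  B_le : paramB d ρ ε p η ≤ min 1 (min (σ / L) (1 / L))
  delta_le : paramDelta ρ ε ≤ 1
  /-- At least one iteration is made. -/
  one_le_K : 1 ≤ paramK d ρ ε p η

end

noncomputable section

/-! ### Smoothness of the objective -/

section Smooth

variable {d : ℕ}

/-! Fix the starting point and a possible exit step n ≤ ⌈K₀⌉. Near x⁰ the objective is a quadratic
with gradient g and Hessian H, up to errors of order ρB³, and x^k - x⁰ follows gradient descent on
this quadratic, perturbed by Taylor remainders of size ρB² and by the noise. An eigenbasis of H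
splits this into scalar recursions. Where the curvature is positive, the recursion is solved and
compared with noiseless descent; elsewhere, concavity makes first-order decrease add up along the
actual path. Both give a decrease of order η ∑ ‖G_k‖², with G_k a `driftGradient` (`quadratic_le`).
Leaving the ball forces η ∑ ‖G_k‖ to be almost B, so by Cauchy–Schwarz the decrease is of order
B²/(ηn) (`quadratic_le_of_displacement`). Since 16ρBηK₀ = 1, this is a multiple of ρB³ large enough
to absorb all errors and to leave 16/7 ρB³ = B²/(7ηK₀).

The noise enters through its propagated displacement, its energy in the directions of positive
curvature, and its pairing with predictable gradients. The first two obey a dimension-free tail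
bound (`meas_norm_sq_sum_ge_le`), the third an Azuma bound whose variance is absorbed by the
decrease (`meas_sum_inner_ge_le`). If ‖g‖ > 5σ, the gradient dominates the noise pathwise and no
tail bound is needed. A union bound over n and Fubini in x⁰ conclude. -/

theorem measurable_stochGrad {Z : Type*} [MeasurableSpace Z]
    {F : EuclideanSpace ℝ (Fin d) → Z → ℝ} (hFmeas : ∀ x, Measurable (F x))
    (hFdiff : ∀ z, Differentiable ℝ (fun x => F x z)) (x : EuclideanSpace ℝ (Fin d)) :
    Measurable (stochGrad F x) := by
  have key : ∀ v : EuclideanSpace ℝ (Fin d),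
      Measurable (fun z => fderiv ℝ (fun y => F y z) x v) := by
    intro v
    -- A directional derivative is the limit of difference quotients with increment v/n, each
    -- measurable in z.
    refine measurable_of_tendsto_metrizable
      (f := fun (n : ℕ) z => (n : ℝ) • (F (x + (n : ℝ)⁻¹ • v) z - F x z)) ?_ ?_
    · intro n
      exact ((hFmeas _).sub (hFmeas _)).const_smul (n : ℝ)
    · rw [tendsto_pi_nhds]
      intro z
      have h := ((hFdiff z) x).hasFDerivAt.lim_real v
      exact h.comp tendsto_natCast_atTop_atTop
  have hsum : stochGrad F x = fun z => ∑ i, (fderiv ℝ (fun y => F y z) x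
      ((EuclideanSpace.basisFun (Fin d) ℝ) i)) • (EuclideanSpace.basisFun (Fin d) ℝ) i := by
    funext z
    rw [← (EuclideanSpace.basisFun (Fin d) ℝ).sum_repr' (stochGrad F x z)]
    refine Finset.sum_congr rfl fun i _ => ?_
    rw [real_inner_comm, stochGrad, inner_gradient_left]
  rw [hsum]
  exact Finset.measurable_sum _ fun i _ => (key _).smul_const _

theorem measurable_uncurry_stochGrad {Z : Type*} [MeasurableSpace Z]
    {F : EuclideanSpace ℝ (Fin d) → Z → ℝ} {L : ℝ} (hFmeas : ∀ x, Measurable (F x))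
    (hFdiff : ∀ z, Differentiable ℝ (fun x => F x z))
    (hgrad : ∀ z x y, ‖stochGrad F x z - stochGrad F y z‖ ≤ L * ‖x - y‖) :
    Measurable (fun q : EuclideanSpace ℝ (Fin d) × Z => stochGrad F q.1 q.2) := by
  refine (stronglyMeasurable_uncurry_of_continuous_of_stronglyMeasurable
    (u := fun x z => stochGrad F x z) (fun z => ?_)
    fun x => (measurable_stochGrad hFmeas hFdiff x).stronglyMeasurable).measurable
  exact (LipschitzWith.of_dist_le_mul (K := L.toNNReal) fun x y => by
    rw [dist_eq_norm, dist_eq_norm]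
    exact (hgrad z x y).trans
      (mul_le_mul_of_nonneg_right (Real.le_coe_toNNReal L) (norm_nonneg _))).continuous

theorem norm_le_of_norm_sub_sq_le {E : Type*} [SeminormedAddCommGroup E] {a b : E} {σ : ℝ}
    (hσ : 0 ≤ σ) (h : ‖a - b‖ ^ 2 ≤ σ ^ 2) : ‖a - b‖ ≤ σ :=
  (sq_le_sq₀ (norm_nonneg _) hσ).1 h

theorem integrable_stochGrad {Z : Type*} [MeasurableSpace Z] {D : Measure Z}
    [IsProbabilityMeasure D] {F : EuclideanSpace ℝ (Fin d) → Z → ℝ} {σ : ℝ} (hσ : 0 ≤ σ)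
    (hFmeas : ∀ x, Measurable (F x)) (hFdiff : ∀ z, Differentiable ℝ (fun x => F x z))
    (hnoise : ∀ x, ∀ᵐ z ∂D, ‖stochGrad F x z - gradient (objective F D) x‖ ^ 2 ≤ σ ^ 2)
    (x : EuclideanSpace ℝ (Fin d)) : Integrable (stochGrad F x) D := by
  refine Integrable.of_bound (measurable_stochGrad hFmeas hFdiff x).aestronglyMeasurable
    (‖gradient (objective F D) x‖ + σ) ?_
  filter_upwards [hnoise x] with z hz
  have := norm_le_of_norm_sub_sq_le hσ hz
  linarith [norm_le_norm_add_norm_sub (gradient (objective F D) x) (stochGrad F x z),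
    norm_sub_rev (gradient (objective F D) x) (stochGrad F x z)]

/-- Differentiation under the integral. The noise bound is used at the centre x only, so one null
set suffices; the Lipschitz bound, valid for every sample, extends it to the unit ball and yields a
constant dominating function. -/
theorem integral_stochGrad {Z : Type*} [MeasurableSpace Z] {D : Measure Z}
    [IsProbabilityMeasure D] {F : EuclideanSpace ℝ (Fin d) → Z → ℝ} {L σ : ℝ} (hL : 0 ≤ L)
    (hσ : 0 ≤ σ)
    (hFmeas : ∀ x, Measurable (F x)) (hFint : ∀ x, Integrable (F x) D)
    (hFdiff : ∀ z, Differentiable ℝ (fun x => F x z))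
    (hgrad : ∀ z x y, ‖stochGrad F x z - stochGrad F y z‖ ≤ L * ‖x - y‖)
    (hnoise : ∀ x, ∀ᵐ z ∂D, ‖stochGrad F x z - gradient (objective F D) x‖ ^ 2 ≤ σ ^ 2)
    (x : EuclideanSpace ℝ (Fin d)) :
    ∫ z, stochGrad F x z ∂D = gradient (objective F D) x := by
  have hint := integrable_stochGrad hσ hFmeas hFdiff hnoise x
  have hdual : ∀ y z, fderiv ℝ (fun y => F y z) y =
      InnerProductSpace.toDual ℝ (EuclideanSpace ℝ (Fin d)) (stochGrad F y z) := by
    intro y z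
    rw [stochGrad, toDual_gradient]
  have hmeas' : AEStronglyMeasurable (fun z => fderiv ℝ (fun y => F y z) x) D := by
    simp_rw [hdual]
    exact (InnerProductSpace.toDual ℝ (EuclideanSpace ℝ (Fin d))).continuous.comp_aestronglyMeasurable
      hint.aestronglyMeasurable
  have hD : HasFDerivAt (objective F D) (∫ z, fderiv ℝ (fun y => F y z) x ∂D) x := by
    refine hasFDerivAt_integral_of_dominated_of_fderiv_le
      (F' := fun y z => fderiv ℝ (fun y => F y z) y)
      (bound := fun _ => ‖gradient (objective F D) x‖ + σ + L)
      (Metric.ball_mem_nhds x one_pos)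
      (Filter.Eventually.of_forall fun y => (hFmeas y).aestronglyMeasurable) (hFint x) hmeas'
      ?_ (integrable_const _)
      (Filter.Eventually.of_forall fun z y _ => ((hFdiff z) y).hasFDerivAt)
    filter_upwards [hnoise x] with z hz y hy
    rw [hdual, LinearIsometryEquiv.norm_map]
    have h1 := norm_le_of_norm_sub_sq_le hσ hz
    have h2 := hgrad z y x
    have h3 : L * ‖y - x‖ ≤ L := by
      rw [mem_ball_iff_norm] at hy
      nlinarith
    have h4 := norm_le_norm_add_norm_sub (gradient (objective F D) x) (stochGrad F x z)
    have h5 := norm_le_norm_add_norm_sub (stochGrad F x z) (stochGrad F y z)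
    rw [norm_sub_rev] at h4 h5
    linarith
  have hG : gradient (objective F D) x =
      (InnerProductSpace.toDual ℝ (EuclideanSpace ℝ (Fin d))).symm
        (∫ z, fderiv ℝ (fun y => F y z) x ∂D) := by
    rw [gradient, hD.fderiv]
  rw [hG, LinearIsometryEquiv.eq_symm_apply]
  simp_rw [hdual]
  exact ((InnerProductSpace.toDual ℝ
    (EuclideanSpace ℝ (Fin d))).toContinuousLinearEquiv.integral_comp_comm _).symm

theorem norm_gradient_objective_sub_le {Z : Type*} [MeasurableSpace Z] {D : Measure Z}
    [IsProbabilityMeasure D] {F : EuclideanSpace ℝ (Fin d) → Z → ℝ} {L : ℝ}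
    (hint : ∀ x, Integrable (stochGrad F x) D)
    (hmean : ∀ x, ∫ z, stochGrad F x z ∂D = gradient (objective F D) x)
    (hgrad : ∀ z x y, ‖stochGrad F x z - stochGrad F y z‖ ≤ L * ‖x - y‖)
    (x y : EuclideanSpace ℝ (Fin d)) :
    ‖gradient (objective F D) x - gradient (objective F D) y‖ ≤ L * ‖x - y‖ := by
  rw [← hmean, ← hmean, ← integral_sub (hint x) (hint y)]
  have := norm_integral_le_of_norm_le_const (μ := D)
    (f := fun z => stochGrad F x z - stochGrad F y z)
    (Filter.Eventually.of_forall fun z => hgrad z x y)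
  simpa using this

variable {f : EuclideanSpace ℝ (Fin d) → ℝ}

theorem differentiable_gradient (hf : ContDiff ℝ 2 f) : Differentiable ℝ (gradient f) := by
  have h : ContDiff ℝ 1 (fderiv ℝ f) := hf.fderiv_right (by norm_num)
  exact (InnerProductSpace.toDual ℝ
    (EuclideanSpace ℝ (Fin d))).symm.toContinuousLinearEquiv.differentiable.comp
    (h.differentiable (by norm_num))

theorem inner_hessian (hf : ContDiff ℝ 2 f) (x u v : EuclideanSpace ℝ (Fin d)) :
    inner ℝ (hessian f x u) v = fderiv ℝ (fderiv ℝ f) x u v := by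
  have h1 : fderiv ℝ f =
      fun y => InnerProductSpace.toDual ℝ (EuclideanSpace ℝ (Fin d)) (gradient f y) := by
    funext y
    rw [toDual_gradient]
  have h2 := ((InnerProductSpace.toDual ℝ
    (EuclideanSpace ℝ (Fin d))).toContinuousLinearEquiv.hasFDerivAt.comp x
      (differentiable_gradient hf x).hasFDerivAt).fderiv
  exact (congrArg (fun T => T u v) ((congrArg (fun G => fderiv ℝ G x) h1).trans h2)).symm

theorem inner_hessian_comm (hf : ContDiff ℝ 2 f) (x u v : EuclideanSpace ℝ (Fin d)) :
    inner ℝ (hessian f x u) v = inner ℝ u (hessian f x v) := by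
  have h : IsSymmSndFDerivAt ℝ f x := hf.contDiffAt.isSymmSndFDerivAt (by simp)
  rw [inner_hessian hf, real_inner_comm, inner_hessian hf]
  exact h u v

theorem norm_hessian_le {L : ℝ} (hL : 0 ≤ L)
    (hlip : ∀ x y, ‖gradient f x - gradient f y‖ ≤ L * ‖x - y‖)
    (x : EuclideanSpace ℝ (Fin d)) : ‖hessian f x‖ ≤ L := by
  have h := norm_fderiv_le_of_lipschitz ℝ (f := gradient f) (x₀ := x) (C := ⟨L, hL⟩)
    (LipschitzWith.of_dist_le_mul fun x y => by
      rw [dist_eq_norm, dist_eq_norm]; exact hlip x y)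
  exact h

theorem norm_gradient_sub_hessian_le {ρ R : ℝ} (hρ : 0 ≤ ρ) (hf : ContDiff ℝ 2 f)
    (hhess : ∀ x y, ‖hessian f x - hessian f y‖ ≤ ρ * ‖x - y‖)
    (x y : EuclideanSpace ℝ (Fin d)) (hxy : ‖y - x‖ ≤ R) :
    ‖gradient f y - gradient f x - hessian f x (y - x)‖ ≤ ρ * R ^ 2 := by
  have hR : 0 ≤ R := (norm_nonneg _).trans hxy
  have h := (convex_closedBall x R).norm_image_sub_le_of_norm_hasFDerivWithin_le'
    (f := gradient f) (f' := hessian f) (φ := hessian f x) (C := ρ * R)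
    (fun z _ => (differentiable_gradient hf z).hasFDerivAt.hasFDerivWithinAt)
    (fun z hz => (hhess z x).trans (mul_le_mul_of_nonneg_left (mem_closedBall_iff_norm.1 hz) hρ))
    (Metric.mem_closedBall_self hR) (mem_closedBall_iff_norm.2 hxy)
  refine h.trans ?_
  nlinarith [mul_nonneg hρ hR]

/-- Mean value inequality for f minus half its Hessian form at x, whose gradient (by symmetry of the
Hessian) stays within ρR² of ∇f(x). The Taylor factor 1/6 is given up. -/
theorem le_add_inner_add_hessian {ρ R : ℝ} (hρ : 0 ≤ ρ) (hf : ContDiff ℝ 2 f)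
    (hhess : ∀ x y, ‖hessian f x - hessian f y‖ ≤ ρ * ‖x - y‖)
    (x y : EuclideanSpace ℝ (Fin d)) (hxy : ‖y - x‖ ≤ R) :
    f y ≤ f x + inner ℝ (gradient f x) (y - x) +
      1 / 2 * inner ℝ (y - x) (hessian f x (y - x)) + ρ * R ^ 3 := by
  have hR : 0 ≤ R := (norm_nonneg _).trans hxy
  set H := hessian f x with hH
  have hder : ∀ z, HasFDerivAt (fun z => f z - 1 / 2 * inner ℝ (z - x) (H (z - x)))
      (InnerProductSpace.toDual ℝ _ (gradient f z - H (z - x))) z := by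
    intro z
    have h1 : HasFDerivAt f (InnerProductSpace.toDual ℝ _ (gradient f z)) z := by
      rw [toDual_gradient]
      exact (hf.differentiable (by norm_num) z).hasFDerivAt
    have h2 : HasFDerivAt (fun z => z - x) (ContinuousLinearMap.id ℝ _) z :=
      (hasFDerivAt_id z).sub_const x
    have h3 : HasFDerivAt (fun z => H (z - x)) (H.comp (ContinuousLinearMap.id ℝ _)) z :=
      H.hasFDerivAt.comp z h2
    have h4 := h1.sub ((h2.inner ℝ h3).const_mul (1 / 2))
    refine h4.congr_fderiv ?_
    ext v
    have hs := inner_hessian_comm hf x (z - x) v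
    rw [← hH] at hs
    have hs' : inner ℝ v (H z - H x) = inner ℝ (H z) v - inner ℝ (H x) v := by
      rw [real_inner_comm, inner_sub_left]
    simp [inner_sub_left, ← hs, hs']
    ring
  have h := (convex_closedBall x R).norm_image_sub_le_of_norm_hasFDerivWithin_le'
    (f' := fun z => InnerProductSpace.toDual ℝ _ (gradient f z - H (z - x)))
    (φ := InnerProductSpace.toDual ℝ _ (gradient f x)) (C := ρ * R ^ 2)
    (fun z _ => (hder z).hasFDerivWithinAt)
    (fun z hz => by
      rw [← map_sub, LinearIsometryEquiv.norm_map, sub_right_comm]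
      exact norm_gradient_sub_hessian_le hρ hf hhess x z (mem_closedBall_iff_norm.1 hz))
    (Metric.mem_closedBall_self hR) (mem_closedBall_iff_norm.2 hxy)
  have h' := (Real.le_norm_self _).trans h
  simp only [InnerProductSpace.toDual_apply_apply, sub_self, map_zero, inner_zero_left, mul_zero,
    sub_zero] at h'
  have : ρ * R ^ 2 * ‖y - x‖ ≤ ρ * R ^ 3 := by
    nlinarith [mul_nonneg hρ (sq_nonneg R)]
  linarith

theorem le_add_inner_add_norm_sq {L : ℝ} (hL : 0 ≤ L) (hf : ContDiff ℝ 2 f)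
    (hlip : ∀ x y, ‖gradient f x - gradient f y‖ ≤ L * ‖x - y‖)
    (x y : EuclideanSpace ℝ (Fin d)) :
    f y ≤ f x + inner ℝ (gradient f x) (y - x) + L * ‖y - x‖ ^ 2 := by
  have h := (convex_closedBall x ‖y - x‖).norm_image_sub_le_of_norm_hasFDerivWithin_le'
    (f := f) (f' := fun z => InnerProductSpace.toDual ℝ _ (gradient f z))
    (φ := InnerProductSpace.toDual ℝ _ (gradient f x)) (C := L * ‖y - x‖)
    (fun z _ => by
      rw [toDual_gradient]
      exact (hf.differentiable (by norm_num) z).hasFDerivAt.hasFDerivWithinAt)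
    (fun z hz => by
      rw [← map_sub, LinearIsometryEquiv.norm_map]
      exact (hlip z x).trans (mul_le_mul_of_nonneg_left (mem_closedBall_iff_norm.1 hz) hL))
    (Metric.mem_closedBall_self (norm_nonneg _)) (mem_closedBall_iff_norm.2 le_rfl)
  have h' := (Real.le_norm_self _).trans h
  simp only [InnerProductSpace.toDual_apply_apply] at h'
  linarith

end Smooth

end

noncomputable section

/-! ### Concentration for adapted sums of bounded noise -/

/-! ### Adapted recursions driven by independent samples -/

section Recursion

variable {S Z Ω : Type*} [MeasurableSpace S] [MeasurableSpace Z] {ζ : ℕ → Ω → Z}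

/-- State k uses only the samples with index below k; this is the source of its independence from `ζ
k`. -/
theorem exists_measurable_of_recursion {step : ℕ → S × Z → S} (hstep : ∀ k, Measurable (step k))
    {s : ℕ → Ω → S} {s₀ : S} (h0 : ∀ ω, s 0 ω = s₀)
    (hs : ∀ k ω, s (k + 1) ω = step k (s k ω, ζ k ω)) (k : ℕ) :
    ∃ h : (Finset.range k → Z) → S, Measurable h ∧ ∀ ω, s k ω = h fun i => ζ i ω := by
  induction k with
  | zero => exact ⟨fun _ => s₀, measurable_const, h0⟩
  | succ k ih =>
    obtain ⟨h, hm, hh⟩ := ih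
    refine ⟨fun t => step k (h fun i => t ⟨i, Finset.mem_range.2
      ((Finset.mem_range.1 i.2).trans (Nat.lt_succ_self k))⟩, t ⟨k, Finset.self_mem_range_succ k⟩),
      ?_, fun ω => by rw [hs, hh]⟩
    exact (hstep k).comp ((hm.comp (measurable_pi_lambda _ fun i => measurable_pi_apply _)).prodMk
      (measurable_pi_apply _))

variable [MeasurableSpace Ω] {D : Measure Z} {μ : Measure Ω}

theorem measurable_of_recursion (hζ : ∀ k, Measurable (ζ k)) {step : ℕ → S × Z → S}
    (hstep : ∀ k, Measurable (step k)) {s : ℕ → Ω → S} {s₀ : S} (h0 : ∀ ω, s 0 ω = s₀)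
    (hs : ∀ k ω, s (k + 1) ω = step k (s k ω, ζ k ω)) (k : ℕ) : Measurable (s k) := by
  obtain ⟨h, hm, hh⟩ := exists_measurable_of_recursion hstep h0 hs k
  rw [funext hh]
  exact hm.comp (measurable_pi_lambda _ fun i => hζ i)

variable [IsProbabilityMeasure μ]

theorem map_state_sample (hζ : ∀ k, Measurable (ζ k)) (hlaw : ∀ k, μ.map (ζ k) = D)
    (hindep : iIndepFun ζ μ) {step : ℕ → S × Z → S} (hstep : ∀ k, Measurable (step k))
    {s : ℕ → Ω → S} {s₀ : S} (h0 : ∀ ω, s 0 ω = s₀)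
    (hs : ∀ k ω, s (k + 1) ω = step k (s k ω, ζ k ω)) (k : ℕ) :
    μ.map (fun ω => (s k ω, ζ k ω)) = (μ.map (s k)).prod D := by
  obtain ⟨h, hm, hh⟩ := exists_measurable_of_recursion hstep h0 hs k
  have hi := hindep.indepFun_finset (Finset.range k) {k} (by simp) hζ
  have hi' : IndepFun (s k) (ζ k) μ := by
    have := hi.comp hm (measurable_pi_apply (⟨k, Finset.mem_singleton_self k⟩ : ({k} : Finset ℕ)))
    rw [funext hh]
    exact this
  rw [← hlaw k]
  exact (indepFun_iff_map_prod_eq_prod_map_map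
    (measurable_of_recursion hζ hstep h0 hs k).aemeasurable (hζ k).aemeasurable).1 hi'

theorem ae_state_sample [IsProbabilityMeasure D] (hζ : ∀ k, Measurable (ζ k))
    (hlaw : ∀ k, μ.map (ζ k) = D)
    (hindep : iIndepFun ζ μ) {step : ℕ → S × Z → S} (hstep : ∀ k, Measurable (step k))
    {s : ℕ → Ω → S} {s₀ : S} (h0 : ∀ ω, s 0 ω = s₀)
    (hs : ∀ k ω, s (k + 1) ω = step k (s k ω, ζ k ω))
    {P : S × Z → Prop} (hP : MeasurableSet {q | P q}) (h : ∀ x, ∀ᵐ z ∂D, P (x, z)) (k : ℕ) :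
    ∀ᵐ ω ∂μ, P (s k ω, ζ k ω) := by
  have hm := (measurable_of_recursion hζ hstep h0 hs k).prodMk (hζ k)
  refine ae_of_ae_map hm.aemeasurable (p := P) ?_
  rw [map_state_sample hζ hlaw hindep hstep h0 hs k, Measure.ae_prod_iff_ae_ae hP]
  exact Filter.Eventually.of_forall h

/-- The supermartingale argument behind both tail bounds: the one-step inequality is checked at each
fixed state, then integrated against the law of the state. -/
theorem lintegral_recursion_le [IsProbabilityMeasure D] (hζ : ∀ k, Measurable (ζ k))
    (hlaw : ∀ k, μ.map (ζ k) = D)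
    (hindep : iIndepFun ζ μ) {step : ℕ → S × Z → S} (hstep : ∀ k, Measurable (step k))
    {s : ℕ → Ω → S} {s₀ : S} (h0 : ∀ ω, s 0 ω = s₀)
    (hs : ∀ k ω, s (k + 1) ω = step k (s k ω, ζ k ω))
    {ψ : ℕ → S → ENNReal} (hψ : ∀ k, Measurable (ψ k)) {K : ℕ}
    (hle : ∀ k < K, ∀ x, ∫⁻ z, ψ (k + 1) (step k (x, z)) ∂D ≤ ψ k x) :
    ∫⁻ ω, ψ K (s K ω) ∂μ ≤ ψ 0 s₀ := by
  have key : ∀ k ≤ K, ∫⁻ ω, ψ k (s k ω) ∂μ ≤ ψ 0 s₀ := by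
    intro k
    induction k with
    | zero => intro _; simp [h0]
    | succ k ih =>
      intro hk
      refine le_trans ?_ (ih (by omega))
      have hm := measurable_of_recursion hζ hstep h0 hs k
      have hg : Measurable fun q : S × Z => ψ (k + 1) (step k q) := (hψ _).comp (hstep k)
      calc ∫⁻ ω, ψ (k + 1) (s (k + 1) ω) ∂μ
          = ∫⁻ q, ψ (k + 1) (step k q) ∂(μ.map fun ω => (s k ω, ζ k ω)) := by
            rw [lintegral_map hg (hm.prodMk (hζ k))]
            simp_rw [hs]
        _ = ∫⁻ x, ∫⁻ z, ψ (k + 1) (step k (x, z)) ∂D ∂(μ.map (s k)) := by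
            rw [map_state_sample hζ hlaw hindep hstep h0 hs k, lintegral_prod _ hg.aemeasurable]
        _ ≤ ∫⁻ x, ψ k x ∂(μ.map (s k)) := lintegral_mono (hle k (by omega))
        _ = ∫⁻ ω, ψ k (s k ω) ∂μ := lintegral_map (hψ k) hm
  exact key K le_rfl

end Recursion

/-! ### Exponential moments and tail bounds -/

section BoundedNoise

variable {E : Type*} [NormedAddCommGroup E] [InnerProductSpace ℝ E] [CompleteSpace E]
  [MeasurableSpace E] [BorelSpace E] [SecondCountableTopology E]
  {Z : Type*} [MeasurableSpace Z] {D : Measure Z} [IsProbabilityMeasure D]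

/-- Hoeffding's lemma: the inner product is centred and lies in an interval of length 2s‖a‖. -/
theorem lintegral_exp_inner_le {ξ : Z → E} {s : ℝ} (hs : 0 ≤ s) (hm : Measurable ξ)
    (hb : ∀ᵐ z ∂D, ‖ξ z‖ ≤ s) (h0 : ∫ z, ξ z ∂D = 0) (a : E) :
    ∫⁻ z, ENNReal.ofReal (Real.exp (inner ℝ a (ξ z))) ∂D ≤
      ENNReal.ofReal (Real.exp (s ^ 2 * ‖a‖ ^ 2 / 2)) := by
  have hint : Integrable ξ D := Integrable.of_bound hm.aestronglyMeasurable s hb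
  have hsub := hasSubgaussianMGF_of_mem_Icc_of_integral_eq_zero (μ := D)
    (X := fun z => inner ℝ a (ξ z)) (a := -(s * ‖a‖)) (b := s * ‖a‖)
    (measurable_const.inner hm).aemeasurable
    (by
      filter_upwards [hb] with z hz
      have h := abs_real_inner_le_norm a (ξ z)
      have h' : ‖a‖ * ‖ξ z‖ ≤ s * ‖a‖ := by
        rw [mul_comm]; exact mul_le_mul_of_nonneg_right hz (norm_nonneg _)
      exact abs_le.1 (h.trans h'))
    (by rw [integral_inner hint, h0, inner_zero_right])
  have hi := hsub.integrable_exp_mul 1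
  have hl := hsub.mgf_le 1
  simp only [one_mul, mgf] at hi hl
  rw [← ofReal_integral_eq_lintegral_ofReal hi (Filter.Eventually.of_forall fun _ =>
    (Real.exp_pos _).le)]
  refine ENNReal.ofReal_le_ofReal (hl.trans (le_of_eq ?_))
  congr 1
  have : |s * ‖a‖ - -(s * ‖a‖)| = 2 * (s * ‖a‖) := by
    rw [abs_of_nonneg] <;> nlinarith [mul_nonneg hs (norm_nonneg a)]
  simp only [NNReal.coe_pow, NNReal.coe_div, coe_nnnorm, Real.norm_eq_abs, this]
  push_cast
  ring

/-- In the expanded square, ‖ξ‖² is at most s² and the linear term is Hoeffding's lemma for the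
vector 2lM. No dimension enters. -/
theorem lintegral_exp_norm_sq_add_le {ξ : Z → E} {s l : ℝ} (hs : 0 ≤ s) (hl : 0 ≤ l)
    (hm : Measurable ξ) (hb : ∀ᵐ z ∂D, ‖ξ z‖ ≤ s) (h0 : ∫ z, ξ z ∂D = 0) (M : E) :
    ∫⁻ z, ENNReal.ofReal (Real.exp (l * ‖M + ξ z‖ ^ 2)) ∂D ≤
      ENNReal.ofReal (Real.exp (l * (1 + 2 * l * s ^ 2) * ‖M‖ ^ 2 + l * s ^ 2)) := by
  calc ∫⁻ z, ENNReal.ofReal (Real.exp (l * ‖M + ξ z‖ ^ 2)) ∂D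
      ≤ ∫⁻ z, ENNReal.ofReal (Real.exp (l * ‖M‖ ^ 2 + l * s ^ 2)) *
          ENNReal.ofReal (Real.exp (inner ℝ ((2 * l) • M) (ξ z))) ∂D := by
        refine lintegral_mono_ae ?_
        filter_upwards [hb] with z hz
        rw [← ENNReal.ofReal_mul (Real.exp_pos _).le, ← Real.exp_add]
        refine ENNReal.ofReal_le_ofReal (Real.exp_le_exp.2 ?_)
        rw [norm_add_sq_real, real_inner_smul_left]
        have : ‖ξ z‖ ^ 2 ≤ s ^ 2 := pow_le_pow_left₀ (norm_nonneg _) hz 2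
        nlinarith [mul_le_mul_of_nonneg_left this hl]
    _ ≤ ENNReal.ofReal (Real.exp (l * ‖M‖ ^ 2 + l * s ^ 2)) *
          ENNReal.ofReal (Real.exp (s ^ 2 * ‖(2 * l) • M‖ ^ 2 / 2)) := by
        rw [lintegral_const_mul' _ _ ENNReal.ofReal_ne_top]
        exact mul_le_mul_right (lintegral_exp_inner_le hs hm hb h0 _) _
    _ = _ := by
        rw [← ENNReal.ofReal_mul (Real.exp_pos _).le, ← Real.exp_add, norm_smul,
          Real.norm_of_nonneg (by positivity)]
        congr 2
        ring

theorem meas_le_of_lintegral_exp_le {Ω : Type*} [MeasurableSpace Ω] {μ : Measure Ω}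
    {X : Ω → ℝ} (hX : Measurable X) {c Λ : ℝ}
    (h : ∫⁻ ω, ENNReal.ofReal (Real.exp (X ω)) ∂μ ≤ ENNReal.ofReal c) :
    μ {ω | Λ ≤ X ω} ≤ ENNReal.ofReal (c * Real.exp (-Λ)) := by
  have hmk := mul_meas_ge_le_lintegral₀ (μ := μ)
    (f := fun ω => ENNReal.ofReal (Real.exp (X ω)))
    (Real.measurable_exp.comp hX).ennreal_ofReal.aemeasurable (ENNReal.ofReal (Real.exp Λ))
  have hset : {ω | ENNReal.ofReal (Real.exp Λ) ≤ ENNReal.ofReal (Real.exp (X ω))} =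
      {ω | Λ ≤ X ω} := by
    ext ω
    simp [ENNReal.ofReal_le_ofReal_iff (Real.exp_pos _).le]
  rw [hset] at hmk
  have h2 := mul_le_mul_right (hmk.trans h) (ENNReal.ofReal (Real.exp (-Λ)))
  rw [← mul_assoc, ← ENNReal.ofReal_mul (Real.exp_pos _).le, ← Real.exp_add,
    ← ENNReal.ofReal_mul (Real.exp_pos _).le, neg_add_cancel, Real.exp_zero,
    ENNReal.ofReal_one, one_mul, mul_comm] at h2
  exact h2

variable {X Ω : Type*} [MeasurableSpace X] [MeasurableSpace Ω] {μ : Measure Ω}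
  [IsProbabilityMeasure μ] {ζ : ℕ → Ω → Z}

/-- Azuma's inequality for the sums of `⟪a_j, ξ_j⟫` with predictable `a_j`, the variance being
subtracted. -/
theorem meas_sum_inner_ge_le (hζ : ∀ k, Measurable (ζ k)) (hlaw : ∀ k, μ.map (ζ k) = D)
    (hindep : iIndepFun ζ μ) {step : X × Z → X} (hstep : Measurable step)
    {x : ℕ → Ω → X} {x₀ : X} (hx0 : ∀ ω, x 0 ω = x₀)
    (hx : ∀ k ω, x (k + 1) ω = step (x k ω, ζ k ω))
    {ξ : X × Z → E} (hξ : Measurable ξ) {s : ℝ} (hs : 0 ≤ s)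
    (hb : ∀ y, ∀ᵐ z ∂D, ‖ξ (y, z)‖ ≤ s) (hmean : ∀ y, ∫ z, ξ (y, z) ∂D = 0)
    {a : ℕ → X → E} (ha : ∀ k, Measurable (a k)) (K : ℕ) (Λ : ℝ) :
    μ {ω | Λ ≤ ∑ j ∈ Finset.range K, (inner ℝ (a j (x j ω)) (ξ (x j ω, ζ j ω)) -
        s ^ 2 * ‖a j (x j ω)‖ ^ 2 / 2)} ≤ ENNReal.ofReal (Real.exp (-Λ)) := by
  set N : ℕ → Ω → ℝ := fun k ω => ∑ j ∈ Finset.range k,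
    (inner ℝ (a j (x j ω)) (ξ (x j ω, ζ j ω)) - s ^ 2 * ‖a j (x j ω)‖ ^ 2 / 2) with hN
  -- The running sum joins the state, so that its exponential is a function of the state.
  set st : ℕ → (X × ℝ) × Z → X × ℝ := fun k q => (step (q.1.1, q.2),
    q.1.2 + (inner ℝ (a k q.1.1) (ξ (q.1.1, q.2)) - s ^ 2 * ‖a k q.1.1‖ ^ 2 / 2)) with hst
  have hstm : ∀ k, Measurable (st k) := by
    intro k
    have h1 : Measurable fun q : (X × ℝ) × Z => (q.1.1, q.2) := by fun_prop
    have h2 : Measurable fun q : (X × ℝ) × Z => a k q.1.1 :=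
      (ha k).comp (measurable_fst.comp measurable_fst)
    exact (hstep.comp h1).prodMk ((measurable_snd.comp measurable_fst).add
      ((h2.inner (hξ.comp h1)).sub (((h2.norm.pow_const 2).const_mul _).div_const 2)))
  have hrec : ∀ k ω, ((x (k + 1) ω, N (k + 1) ω) : X × ℝ) = st k ((x k ω, N k ω), ζ k ω) := by
    intro k ω
    simp only [hN, hst, hx, Finset.sum_range_succ]
  have h0 : ∀ ω, ((x 0 ω, N 0 ω) : X × ℝ) = (x₀, 0) := by
    intro ω; simp [hN, hx0]
  have hmeas := measurable_of_recursion (s := fun k ω => (x k ω, N k ω)) hζ hstm h0 hrec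
  have hint := lintegral_recursion_le (s := fun k ω => (x k ω, N k ω)) (K := K)
    (ψ := fun _ q => ENNReal.ofReal (Real.exp q.2)) hζ hlaw hindep hstm h0 hrec
    (fun _ => (Real.measurable_exp.comp measurable_snd).ennreal_ofReal) (by
      rintro k - ⟨y, n⟩
      simp only [hst]
      have h1 : ∀ z, ENNReal.ofReal (Real.exp (n + (inner ℝ (a k y) (ξ (y, z)) -
          s ^ 2 * ‖a k y‖ ^ 2 / 2))) = ENNReal.ofReal (Real.exp (n - s ^ 2 * ‖a k y‖ ^ 2 / 2)) *
          ENNReal.ofReal (Real.exp (inner ℝ (a k y) (ξ (y, z)))) := by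
        intro z
        rw [← ENNReal.ofReal_mul (Real.exp_pos _).le, ← Real.exp_add]
        congr 2; ring
      simp_rw [h1]
      rw [lintegral_const_mul' _ _ ENNReal.ofReal_ne_top]
      refine (mul_le_mul_right (lintegral_exp_inner_le hs
        (hξ.comp measurable_prodMk_left) (hb y) (hmean y) (a k y)) _).trans (le_of_eq ?_)
      rw [← ENNReal.ofReal_mul (Real.exp_pos _).le, ← Real.exp_add]
      congr 2; ring)
  have := meas_le_of_lintegral_exp_le (μ := μ) (X := N K) (c := 1) (Λ := Λ)
    (measurable_snd.comp (hmeas K)) (by simpa using hint)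
  rw [one_mul] at this
  exact this

/-- A dimension-free tail bound for the norm of a weighted sum of bounded, conditionally centred
vectors. -/
theorem meas_norm_sq_sum_ge_le (hζ : ∀ k, Measurable (ζ k)) (hlaw : ∀ k, μ.map (ζ k) = D)
    (hindep : iIndepFun ζ μ) {step : X × Z → X} (hstep : Measurable step)
    {x : ℕ → Ω → X} {x₀ : X} (hx0 : ∀ ω, x 0 ω = x₀)
    (hx : ∀ k ω, x (k + 1) ω = step (x k ω, ζ k ω))
    {ξ : X × Z → E} (hξ : Measurable ξ) {s : ℝ} (hs : 0 ≤ s)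
    (hb : ∀ y, ∀ᵐ z ∂D, ‖ξ (y, z)‖ ≤ s) (hmean : ∀ y, ∫ z, ξ (y, z) ∂D = 0)
    {A : ℕ → E →L[ℝ] E} {b : ℕ → ℝ} (hb0 : ∀ k, 0 ≤ b k) {K : ℕ}
    (hA : ∀ k < K, ∀ v, ‖A k v‖ ≤ b k * ‖v‖)
    {V : ℝ} (hV : 0 < V) (hbV : ∑ j ∈ Finset.range K, (b j * s) ^ 2 ≤ V) (Λ : ℝ) :
    μ {ω | 4 * V * Λ ≤ ‖∑ j ∈ Finset.range K, A j (ξ (x j ω, ζ j ω))‖ ^ 2} ≤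
      ENNReal.ofReal (2 * Real.exp (-Λ)) := by
  set M : ℕ → Ω → E := fun k ω => ∑ j ∈ Finset.range k, A j (ξ (x j ω, ζ j ω)) with hM
  set st : ℕ → (X × E) × Z → X × E := fun k q => (step (q.1.1, q.2),
    q.1.2 + A k (ξ (q.1.1, q.2))) with hst
  have hstm : ∀ k, Measurable (st k) := by
    intro k
    have h1 : Measurable fun q : (X × E) × Z => (q.1.1, q.2) := by fun_prop
    exact (hstep.comp h1).prodMk ((measurable_snd.comp measurable_fst).add
      ((A k).continuous.measurable.comp (hξ.comp h1)))
  have hrec : ∀ k ω, ((x (k + 1) ω, M (k + 1) ω) : X × E) = st k ((x k ω, M k ω), ζ k ω) := by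
    intro k ω
    simp only [hM, hst, hx, Finset.sum_range_succ]
  have h0 : ∀ ω, ((x 0 ω, M 0 ω) : X × E) = (x₀, 0) := by
    intro ω; simp [hM, hx0]
  have hmeas := measurable_of_recursion (s := fun k ω => (x k ω, M k ω)) hζ hstm h0 hrec
  set W : ℕ → ℝ := fun k => ∑ j ∈ Finset.range k, (b j * s) ^ 2 with hW
  have hW0 : ∀ k, 0 ≤ W k := fun k => Finset.sum_nonneg fun _ _ => sq_nonneg _
  -- The exponent falls as variance accumulates, from 1/(2V) to at least 1/(4V), which compensates
  -- the factor 1 + 2lc gained in each step. The reserve (W K - W k)/(2V) in the potential pays for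
  -- the additive terms lc.
  set l : ℕ → ℝ := fun k => (2 * V + 2 * W k)⁻¹ with hl
  have hl0 : ∀ k, 0 < l k := fun k => by
    have := hW0 k
    simp only [hl]; positivity
  have hint := lintegral_recursion_le (s := fun k ω => (x k ω, M k ω)) (K := K)
    (ψ := fun k q => ENNReal.ofReal (Real.exp (l k * ‖q.2‖ ^ 2 + (W K - W k) / (2 * V))))
    hζ hlaw hindep hstm h0 hrec
    (fun k => (Real.measurable_exp.comp (((measurable_snd.norm.pow_const 2).const_mul _).add_const
      _)).ennreal_ofReal) (by
      rintro k hk ⟨y, m⟩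
      simp only [hst]
      have h1 : ∀ z, ENNReal.ofReal (Real.exp (l (k + 1) * ‖m + A k (ξ (y, z))‖ ^ 2 +
          (W K - W (k + 1)) / (2 * V))) =
          ENNReal.ofReal (Real.exp ((W K - W (k + 1)) / (2 * V))) *
          ENNReal.ofReal (Real.exp (l (k + 1) * ‖m + A k (ξ (y, z))‖ ^ 2)) := by
        intro z
        rw [← ENNReal.ofReal_mul (Real.exp_pos _).le, ← Real.exp_add, add_comm]
      simp_rw [h1]
      rw [lintegral_const_mul' _ _ ENNReal.ofReal_ne_top]
      have hint : Integrable (fun z => ξ (y, z)) D :=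
        Integrable.of_bound (hξ.comp measurable_prodMk_left).aestronglyMeasurable s (hb y)
      have h2 := lintegral_exp_norm_sq_add_le (D := D) (ξ := fun z => A k (ξ (y, z)))
        (s := b k * s) (l := l (k + 1)) (mul_nonneg (hb0 k) hs) (hl0 _).le
        ((A k).continuous.measurable.comp (hξ.comp measurable_prodMk_left))
        (by
          filter_upwards [hb y] with z hz
          exact (hA k hk _).trans (mul_le_mul_of_nonneg_left hz (hb0 k)))
        (by rw [(A k).integral_comp_comm hint, hmean, map_zero]) m
      refine (mul_le_mul_right h2 _).trans ?_
      rw [← ENNReal.ofReal_mul (Real.exp_pos _).le, ← Real.exp_add]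
      refine ENNReal.ofReal_le_ofReal (Real.exp_le_exp.2 ?_)
      have hWs : W (k + 1) = W k + (b k * s) ^ 2 := by simp only [hW, Finset.sum_range_succ]
      set c := (b k * s) ^ 2 with hc
      have hc0 : 0 ≤ c := sq_nonneg _
      have hA1 : l (k + 1) * (1 + 2 * l (k + 1) * c) ≤ l k := by
        have e1 : l (k + 1) = (2 * V + 2 * W k + 2 * c)⁻¹ := by
          simp only [hl, hWs]; ring_nf
        have hp : 0 < 2 * V + 2 * W k := by linarith [hW0 k]
        rw [e1]
        simp only [hl]
        generalize 2 * V + 2 * W k = t at hp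
        rw [show (t + 2 * c)⁻¹ * (1 + 2 * (t + 2 * c)⁻¹ * c) = (t + 4 * c) / (t + 2 * c) ^ 2 by
          field_simp; ring, ← one_div, div_le_div_iff₀ (by positivity) hp]
        nlinarith [sq_nonneg c]
      have hA2 : l (k + 1) * c ≤ c / (2 * V) := by
        rw [div_eq_inv_mul]
        refine mul_le_mul_of_nonneg_right ?_ hc0
        exact inv_anti₀ (by positivity) (by linarith [hW0 (k + 1)])
      have hA3 : (W K - W (k + 1)) / (2 * V) + c / (2 * V) = (W K - W k) / (2 * V) := by
        rw [hWs]; ring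
      have hA4 := mul_le_mul_of_nonneg_right hA1 (sq_nonneg ‖m‖)
      linarith)
  have hfin : ∫⁻ ω, ENNReal.ofReal (Real.exp (‖M K ω‖ ^ 2 / (4 * V))) ∂μ ≤
      ENNReal.ofReal 2 := by
    refine le_trans (lintegral_mono fun ω => ?_) (hint.trans ?_)
    · refine ENNReal.ofReal_le_ofReal (Real.exp_le_exp.2 ?_)
      rw [sub_self, zero_div, add_zero, div_eq_inv_mul]
      refine mul_le_mul_of_nonneg_right (inv_anti₀ ?_ ?_) (sq_nonneg _)
      · linarith [hW0 K]
      · simp only [hW]; linarith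
    -- The initial potential exp(W K/(2V)) ≤ exp(1/2) gives the factor 2 of the tail bound.
    · refine ENNReal.ofReal_le_ofReal ?_
      have h1 : W K / (2 * V) ≤ 1 / 2 := by
        rw [div_le_div_iff₀ (by positivity) (by norm_num)]
        simp only [hW]; linarith
      have h2 : Real.exp (1 / 2) ≤ 2 := by
        have h3 : Real.exp (1 / 2) ^ 2 = Real.exp 1 := by
          rw [← Real.exp_nat_mul]; norm_num
        nlinarith [Real.exp_one_lt_d9, Real.exp_pos (1 / 2)]
      refine le_trans (Real.exp_le_exp.2 ?_) h2
      simpa [hW] using h1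
  have := meas_le_of_lintegral_exp_le (μ := μ) (Λ := Λ)
    (((measurable_snd.comp (hmeas K)).norm.pow_const 2).div_const (4 * V)) hfin
  refine le_trans (measure_mono fun ω hω => ?_) this
  simp only [Set.mem_ofPred_eq] at hω ⊢
  rw [le_div_iff₀ (by positivity)]
  simp only [Function.comp]
  linarith

end BoundedNoise

end

noncomputable section

/-! ### Perturbed gradient descent on a quadratic function -/

/-! ### Scalar recursions in one eigendirection -/

section Coordinate

open Finset

variable {η g l : ℝ} {w : ℕ → ℝ} {n : ℕ}

theorem linear_recursion_eq {e : ℕ → ℝ} (h0 : w 0 = 0)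
    (hw : ∀ k < n, w (k + 1) = w k - η * (g + l * w k + e k)) :
    w n = -(η * ∑ k ∈ range n, (1 - η * l) ^ k * g) -
      η * ∑ k ∈ range n, (1 - η * l) ^ (n - 1 - k) * e k := by
  induction n with
  | zero => simp [h0]
  | succ n ih =>
    have ih := ih fun k hk => hw k (by omega)
    rw [hw n (by omega), sum_range_succ', sum_range_succ (fun k => _ ^ (n + 1 - 1 - k) * e k)]
    have h1 : ∑ k ∈ range n, (1 - η * l) ^ (k + 1) * g =
        (1 - η * l) * ∑ k ∈ range n, (1 - η * l) ^ k * g := by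
      rw [mul_sum]; exact sum_congr rfl fun k _ => by ring
    have h2 : ∑ k ∈ range n, (1 - η * l) ^ (n + 1 - 1 - k) * e k =
        (1 - η * l) * ∑ k ∈ range n, (1 - η * l) ^ (n - 1 - k) * e k := by
      rw [mul_sum]
      refine sum_congr rfl fun k hk => ?_
      rw [show n + 1 - 1 - k = (n - 1 - k) + 1 by have := mem_range.1 hk; omega]
      ring
    rw [h1, h2, ih]
    simp
    ring

/-- Each noiseless step multiplies the gradient G by 1 - ηl and lowers the quadratic by exactly η(1
- ηl/2)G². -/
theorem gradient_descent_quadratic (n : ℕ) :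
    g + l * (-(η * ∑ k ∈ range n, (1 - η * l) ^ k * g)) = (1 - η * l) ^ n * g ∧
    g * (-(η * ∑ k ∈ range n, (1 - η * l) ^ k * g)) +
      1 / 2 * l * (-(η * ∑ k ∈ range n, (1 - η * l) ^ k * g)) ^ 2 =
      -(η * (1 - η * l / 2) * ∑ k ∈ range n, ((1 - η * l) ^ k * g) ^ 2) := by
  induction n with
  | zero => simp
  | succ n ih =>
    obtain ⟨h1, h2⟩ := ih
    rw [sum_range_succ, sum_range_succ]
    generalize ∑ k ∈ range n, (1 - η * l) ^ k * g = S at *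
    generalize ∑ k ∈ range n, ((1 - η * l) ^ k * g) ^ 2 = Q at *
    have h3 : (1 - η * l) ^ (n + 1) * g = (1 - η * l) * (g + l * (-(η * S))) := by
      rw [h1]; ring
    rw [h3, ← h1]
    constructor
    · ring
    · linear_combination h2

/-- Cauchy–Schwarz with the weights (1 - ηl)^(n-1-k): their sum times ηl is at most 1, which cancels
the curvature. -/
theorem mul_sum_pow_mul_sq_le (hη : 0 ≤ η) (hθ : 0 ≤ 1 - η * l) (hl : 0 ≤ l)
    (r : ℕ → ℝ) (n : ℕ) :
    l * (η * ∑ k ∈ range n, (1 - η * l) ^ (n - 1 - k) * r k) ^ 2 ≤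
      η * ∑ k ∈ range n, r k ^ 2 := by
  set θ := 1 - η * l with hθdef
  have hθ1 : θ ≤ 1 := by nlinarith [mul_nonneg hη hl]
  have hgeom : η * l * ∑ k ∈ range n, θ ^ (n - 1 - k) ≤ 1 := by
    rw [sum_range_reflect (fun m => θ ^ m) n]
    have h := mul_neg_geom_sum θ n
    have : η * l = 1 - θ := by rw [hθdef]; ring
    rw [this, h]
    linarith [pow_nonneg hθ n]
  have hcs : (∑ k ∈ range n, θ ^ (n - 1 - k) * r k) ^ 2 ≤
      (∑ k ∈ range n, θ ^ (n - 1 - k)) * ∑ k ∈ range n, θ ^ (n - 1 - k) * r k ^ 2 :=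
    sum_sq_le_sum_mul_sum_of_sq_le_mul _ (fun _ _ => pow_nonneg hθ _)
      (fun _ _ => mul_nonneg (pow_nonneg hθ _) (sq_nonneg _)) fun _ _ => le_of_eq (by ring)
  have hle : ∑ k ∈ range n, θ ^ (n - 1 - k) * r k ^ 2 ≤ ∑ k ∈ range n, r k ^ 2 :=
    sum_le_sum fun k _ => mul_le_of_le_one_left (sq_nonneg _) (pow_le_one₀ hθ hθ1)
  have hQ : 0 ≤ ∑ k ∈ range n, r k ^ 2 := sum_nonneg fun _ _ => sq_nonneg _
  have hS : 0 ≤ ∑ k ∈ range n, θ ^ (n - 1 - k) := sum_nonneg fun _ _ => pow_nonneg hθ _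
  generalize ∑ k ∈ range n, θ ^ (n - 1 - k) = S at *
  generalize ∑ k ∈ range n, r k ^ 2 = Q at *
  generalize ∑ k ∈ range n, θ ^ (n - 1 - k) * r k ^ 2 = P at *
  calc l * (η * ∑ k ∈ range n, θ ^ (n - 1 - k) * r k) ^ 2
      = l * η ^ 2 * (∑ k ∈ range n, θ ^ (n - 1 - k) * r k) ^ 2 := by ring
    _ ≤ l * η ^ 2 * (S * Q) :=
        mul_le_mul_of_nonneg_left (hcs.trans (mul_le_mul_of_nonneg_left hle hS))
          (mul_nonneg hl (sq_nonneg _))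
    _ = (η * l * S) * (η * Q) := by ring
    _ ≤ η * Q := mul_le_of_le_one_left (mul_nonneg hη hQ) hgeom

/-- The iterate is the noiseless one plus a deviation. The deviation pairs with the noiseless
endpoint gradient (1 - ηl)^n g, and its square splits by (a + b)² ≤ 2a² + 2b² into remainders, which
are summed, and noise, which is kept for the tail bound. -/
theorem quadratic_le_of_pos {r ξ : ℕ → ℝ} (hη : 0 ≤ η) (hl : 0 ≤ l) (hηl : η * l ≤ 1 / 4)
    (h0 : w 0 = 0) (hw : ∀ k < n, w (k + 1) = w k - η * (g + l * w k + (r k + ξ k))) :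
    g * w n + 1 / 2 * l * w n ^ 2 ≤
      -(7 / 8 * η * ∑ k ∈ range n, ((1 - η * l) ^ k * g) ^ 2) -
      η * ∑ k ∈ range n, ((1 - η * l) ^ n * (1 - η * l) ^ (n - 1 - k) * g) * (r k + ξ k) +
      η * ∑ k ∈ range n, r k ^ 2 +
      l * (η * ∑ k ∈ range n, (1 - η * l) ^ (n - 1 - k) * ξ k) ^ 2 := by
  have hr := mul_sum_pow_mul_sq_le hη (by linarith : 0 ≤ 1 - η * l) hl r n
  have hsplit : ∑ k ∈ range n, (1 - η * l) ^ (n - 1 - k) * (r k + ξ k) =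
      ∑ k ∈ range n, (1 - η * l) ^ (n - 1 - k) * r k +
      ∑ k ∈ range n, (1 - η * l) ^ (n - 1 - k) * ξ k := by
    rw [← sum_add_distrib]; exact sum_congr rfl fun _ _ => by ring
  have hcross : ∑ k ∈ range n, ((1 - η * l) ^ n * (1 - η * l) ^ (n - 1 - k) * g) * (r k + ξ k) =
      (1 - η * l) ^ n * g * ∑ k ∈ range n, (1 - η * l) ^ (n - 1 - k) * (r k + ξ k) := by
    rw [mul_sum]; exact sum_congr rfl fun _ _ => by ring
  rw [linear_recursion_eq h0 hw, hcross, hsplit]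
  obtain ⟨h1, h2⟩ := gradient_descent_quadratic (η := η) (g := g) (l := l) n
  have hQ : 0 ≤ ∑ k ∈ range n, ((1 - η * l) ^ k * g) ^ 2 := sum_nonneg fun _ _ => sq_nonneg _
  rw [← h1]
  generalize ∑ k ∈ range n, (1 - η * l) ^ k * g = S at *
  generalize ∑ k ∈ range n, ((1 - η * l) ^ k * g) ^ 2 = Q at *
  generalize ∑ k ∈ range n, (1 - η * l) ^ (n - 1 - k) * r k = R at *
  generalize ∑ k ∈ range n, (1 - η * l) ^ (n - 1 - k) * ξ k = X at *
  have h3 : η * Q * (η * l) ≤ η * Q * (1 / 4) :=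
    mul_le_mul_of_nonneg_left hηl (mul_nonneg hη hQ)
  have h4 : 0 ≤ l * (η * R - η * X) ^ 2 := mul_nonneg hl (sq_nonneg _)
  nlinarith

/-- By concavity the second-order term of each step has the favourable sign, so the first-order
changes telescope. -/
theorem quadratic_le_of_nonpos {e : ℕ → ℝ} (hl : l ≤ 0) (h0 : w 0 = 0)
    (hw : ∀ k < n, w (k + 1) = w k - η * (g + l * w k + e k)) :
    g * w n + 1 / 2 * l * w n ^ 2 ≤
      -(η * ∑ k ∈ range n, (g + l * w k) ^ 2) - η * ∑ k ∈ range n, (g + l * w k) * e k := by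
  induction n with
  | zero => simp [h0]
  | succ n ih =>
    have ih := ih fun k hk => hw k (by omega)
    rw [sum_range_succ, sum_range_succ, hw n (by omega)]
    nlinarith [mul_nonneg (neg_nonneg.2 hl) (sq_nonneg (η * (g + l * w n + e n)))]

theorem sum_range_eq_of_nonpos {e : ℕ → ℝ} (h0 : w 0 = 0)
    (hw : ∀ k < n, w (k + 1) = w k - η * (g + l * w k + e k)) :
    w n = -(η * ∑ k ∈ range n, (g + l * w k)) - η * ∑ k ∈ range n, e k := by
  induction n with
  | zero => simp [h0]
  | succ n ih =>
    have ih := ih fun k hk => hw k (by omega)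
    rw [sum_range_succ, sum_range_succ, hw n (by omega)]
    linarith

/-- By Bernoulli, (1 - x)^m (1 + mx) ≤ (1 - x²)^m ≤ 1. -/
theorem mul_pow_sq_le {x : ℝ} (hx0 : 0 ≤ x) (hx1 : x ≤ 1) (m : ℕ) :
    x * ((1 - x) ^ m) ^ 2 ≤ 1 / (m + 1) := by
  have h1 : ((1 - x) ^ m) ^ 2 ≤ (1 - x) ^ m := by
    have hp : 0 ≤ (1 - x) ^ m := pow_nonneg (by linarith) m
    have hp1 : (1 - x) ^ m ≤ 1 := pow_le_one₀ (by linarith) (by linarith)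
    nlinarith
  have h2 : (1 - x) ^ m * (1 + m * x) ≤ 1 := by
    have hb := one_add_mul_le_pow (show (-2 : ℝ) ≤ x by linarith) m
    calc (1 - x) ^ m * (1 + m * x) ≤ (1 - x) ^ m * (1 + x) ^ m :=
          mul_le_mul_of_nonneg_left hb (pow_nonneg (by linarith) m)
      _ = (1 - x ^ 2) ^ m := by rw [← mul_pow]; ring
      _ ≤ 1 := pow_le_one₀ (by nlinarith) (by nlinarith)
  have hm : (0 : ℝ) ≤ m := m.cast_nonneg
  rw [le_div_iff₀ (by positivity)]
  have h3 : x * (m + 1) ≤ 1 + m * x := by linarith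
  have hp : 0 ≤ (1 - x) ^ m := pow_nonneg (by linarith) m
  calc x * ((1 - x) ^ m) ^ 2 * (m + 1) = ((1 - x) ^ m) ^ 2 * (x * (m + 1)) := by ring
    _ ≤ (1 - x) ^ m * (1 + m * x) :=
        mul_le_mul h1 h3 (by positivity) hp
    _ ≤ 1 := h2

end Coordinate

/-! ### Operators diagonal in an orthonormal basis -/

section Diagonal

variable {E ι : Type*} [NormedAddCommGroup E] [InnerProductSpace ℝ E] [Fintype ι]

/-- The operator that is diagonal in the orthonormal basis `b`, with entries `φ`. -/
def diagOp (b : OrthonormalBasis ι ℝ E) (φ : ι → ℝ) : E →L[ℝ] E :=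
  ∑ i, φ i • (innerSL ℝ (b i)).smulRight (b i)

@[simp]
theorem inner_diagOp (b : OrthonormalBasis ι ℝ E) (φ : ι → ℝ) (i : ι) (v : E) :
    inner ℝ (b i) (diagOp b φ v) = φ i * inner ℝ (b i) v := by
  classical
  simp [diagOp, inner_sum, inner_smul_right, b.inner_eq_ite]

theorem norm_sq_eq_sum_inner (b : OrthonormalBasis ι ℝ E) (v : E) :
    ‖v‖ ^ 2 = ∑ i, inner ℝ (b i) v ^ 2 := by
  rw [← b.sum_sq_norm_inner_right v]
  simp

theorem inner_eq_sum_inner (b : OrthonormalBasis ι ℝ E) (u v : E) :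
    inner ℝ u v = ∑ i, inner ℝ (b i) u * inner ℝ (b i) v := by
  rw [← b.sum_inner_mul_inner u v]
  exact Finset.sum_congr rfl fun i _ => by rw [real_inner_comm]

theorem norm_le_of_abs_inner_le (b : OrthonormalBasis ι ℝ E) {u v : E} {c : ℝ} (hc : 0 ≤ c)
    (h : ∀ i, |inner ℝ (b i) u| ≤ c * |inner ℝ (b i) v|) : ‖u‖ ≤ c * ‖v‖ := by
  rw [← sq_le_sq₀ (norm_nonneg _) (by positivity), mul_pow, norm_sq_eq_sum_inner b,
    norm_sq_eq_sum_inner b, Finset.mul_sum]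
  refine Finset.sum_le_sum fun i _ => ?_
  rw [← sq_abs, ← sq_abs (inner ℝ (b i) v), ← mul_pow]
  exact pow_le_pow_left₀ (abs_nonneg _) (h i) 2

theorem norm_diagOp_apply_le (b : OrthonormalBasis ι ℝ E) {φ : ι → ℝ} {c : ℝ} (hc : 0 ≤ c)
    (h : ∀ i, |φ i| ≤ c) (v : E) : ‖diagOp b φ v‖ ≤ c * ‖v‖ :=
  norm_le_of_abs_inner_le b hc fun i => by
    rw [inner_diagOp, abs_mul]
    exact mul_le_mul_of_nonneg_right (h i) (abs_nonneg _)

theorem ext_inner_basis (b : OrthonormalBasis ι ℝ E) {u v : E}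
    (h : ∀ i, inner ℝ (b i) u = inner ℝ (b i) v) : u = v := by
  rw [← b.sum_repr' u, ← b.sum_repr' v]
  simp_rw [h]

end Diagonal

/-! ### The perturbed recursion in all directions -/

section Quadratic

open Finset

variable {E ι : Type*} [NormedAddCommGroup E] [InnerProductSpace ℝ E] [Fintype ι]

/-- The noise propagator `(1 - η H₊) ^ m`. -/
def propagator (b : OrthonormalBasis ι ℝ E) (l : ι → ℝ) (η : ℝ) (m : ℕ) : E →L[ℝ] E :=
  diagOp b fun i => if 0 < l i then (1 - η * l i) ^ m else 1

/-- The operator `H₊ ^ (1 / 2) (1 - η H₊) ^ m`. -/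
def sqrtPropagator (b : OrthonormalBasis ι ℝ E) (l : ι → ℝ) (η : ℝ) (m : ℕ) : E →L[ℝ] E :=
  diagOp b fun i => if 0 < l i then √(l i) * (1 - η * l i) ^ m else 0

/-- In the directions of positive curvature the gradient `(1 - η H) ^ m g` after `m` noiseless
steps; in the other directions the gradient `g + H w` of the quadratic function at `w`. -/
def driftGradient (b : OrthonormalBasis ι ℝ E) (l : ι → ℝ) (η : ℝ) (H : E →L[ℝ] E) (g : E)
    (m : ℕ) (w : E) : E :=
  diagOp b (fun i => if 0 < l i then (1 - η * l i) ^ m else 0) g +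
    diagOp b (fun i => if 0 < l i then 0 else 1) (g + H w)

variable {b : OrthonormalBasis ι ℝ E} {l : ι → ℝ} {η : ℝ}

theorem norm_propagator_le (hη : 0 ≤ η) (hl : ∀ i, η * l i ≤ 1) (m : ℕ) (v : E) :
    ‖propagator b l η m v‖ ≤ 1 * ‖v‖ := by
  refine norm_diagOp_apply_le b zero_le_one (fun i => ?_) v
  split_ifs with h
  · have h0 : 0 ≤ 1 - η * l i := by linarith [hl i]
    rw [abs_of_nonneg (pow_nonneg h0 m)]
    exact pow_le_one₀ h0 (by nlinarith [mul_nonneg hη h.le])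
  · simp

theorem norm_sqrtPropagator_le (hη : 0 < η) (hl : ∀ i, η * l i ≤ 1) (m : ℕ) (v : E) :
    ‖sqrtPropagator b l η m v‖ ≤ √(1 / (η * (m + 1))) * ‖v‖ := by
  refine norm_diagOp_apply_le b (Real.sqrt_nonneg _) (fun i => Real.abs_le_sqrt ?_) v
  split_ifs with h
  · have h1 := mul_pow_sq_le (mul_nonneg hη.le h.le) (hl i) m
    rw [mul_pow, Real.sq_sqrt h.le, one_div, mul_inv, ← one_div (_ + _ : ℝ), inv_mul_eq_div,
      le_div_iff₀ hη]
    linarith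
  · rw [zero_pow two_ne_zero]; positivity

/-- Lets the gradients of the cross terms, which carry a later index, be absorbed by those of the
decrease. -/
theorem norm_driftGradient_le (hη : 0 ≤ η) (hl : ∀ i, η * l i ≤ 1) {H : E →L[ℝ] E} {g : E}
    {m m' : ℕ} (hm : m ≤ m') (w : E) :
    ‖driftGradient b l η H g m' w‖ ≤ ‖driftGradient b l η H g m w‖ := by
  rw [← one_mul ‖driftGradient b l η H g m w‖]
  refine norm_le_of_abs_inner_le b zero_le_one fun i => ?_
  simp only [driftGradient, inner_add_right, inner_diagOp, one_mul]
  split_ifs with h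
  · have h0 : 0 ≤ 1 - η * l i := by linarith [hl i]
    simp only [zero_mul, add_zero, abs_mul]
    refine mul_le_mul_of_nonneg_right ?_ (abs_nonneg _)
    rw [abs_of_nonneg (pow_nonneg h0 _), abs_of_nonneg (pow_nonneg h0 _)]
    exact pow_le_pow_of_le_one h0 (by nlinarith [mul_nonneg hη h.le]) hm
  · rfl

variable {H : E →L[ℝ] E} {g : E} {w r ξ : ℕ → E} {n : ℕ}

theorem inner_recursion (hH : ∀ i v, inner ℝ (b i) (H v) = l i * inner ℝ (b i) v)
    (hw : ∀ k < n, w (k + 1) = w k - η • (g + H (w k) + (r k + ξ k))) (i : ι) :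
    ∀ k < n, inner ℝ (b i) (w (k + 1)) = inner ℝ (b i) (w k) - η * (inner ℝ (b i) g +
      l i * inner ℝ (b i) (w k) + (inner ℝ (b i) (r k) + inner ℝ (b i) (ξ k))) := by
  intro k hk
  rw [hw k hk]
  simp only [inner_sub_right, inner_smul_right, inner_add_right, hH]

/-- The displacement is driven by the same gradients that measure the decrease; hence an exit forces
a decrease. -/
theorem displacement_eq (hH : ∀ i v, inner ℝ (b i) (H v) = l i * inner ℝ (b i) v)
    (h0 : w 0 = 0)
    (hw : ∀ k < n, w (k + 1) = w k - η • (g + H (w k) + (r k + ξ k))) :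
    w n = -(η • ∑ k ∈ range n, driftGradient b l η H g k (w k)) -
      η • (∑ k ∈ range n, propagator b l η (n - 1 - k) (r k) +
        ∑ k ∈ range n, propagator b l η (n - 1 - k) (ξ k)) := by
  refine ext_inner_basis b fun i => ?_
  have hrec := inner_recursion hH hw i
  have h0' : inner ℝ (b i) (w 0) = 0 := by rw [h0, inner_zero_right]
  simp only [inner_sub_right, inner_neg_right, inner_smul_right, inner_add_right, inner_sum,
    driftGradient, propagator, inner_diagOp, hH]
  split_ifs with h
  · refine (linear_recursion_eq (w := fun k => inner ℝ (b i) (w k))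
      (e := fun k => inner ℝ (b i) (r k) + inner ℝ (b i) (ξ k)) h0' hrec).trans ?_
    rw [← sum_add_distrib]
    simp only [zero_mul, add_zero, mul_add]
  · refine (sum_range_eq_of_nonpos (w := fun k => inner ℝ (b i) (w k))
      (e := fun k => inner ℝ (b i) (r k) + inner ℝ (b i) (ξ k)) h0' hrec).trans ?_
    rw [← sum_add_distrib]
    simp only [zero_mul, zero_add, one_mul]

/-- The index n + (n-1-k) arises from pairing the propagated noise (1 - ηl)^(n-1-k) ξ_k with the
endpoint gradient (1 - ηl)^n g. The resulting coefficient of ξ_k depends on w_k only, so it is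
predictable. -/
theorem quadratic_le (hη : 0 ≤ η) (hl : ∀ i, η * l i ≤ 1 / 4)
    (hH : ∀ i v, inner ℝ (b i) (H v) = l i * inner ℝ (b i) v) (h0 : w 0 = 0)
    (hw : ∀ k < n, w (k + 1) = w k - η • (g + H (w k) + (r k + ξ k))) :
    inner ℝ g (w n) + 1 / 2 * inner ℝ (w n) (H (w n)) ≤
      -(7 / 8 * η * ∑ k ∈ range n, ‖driftGradient b l η H g k (w k)‖ ^ 2) -
      η * (∑ k ∈ range n, inner ℝ (driftGradient b l η H g (n + (n - 1 - k)) (w k)) (r k) +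
        ∑ k ∈ range n, inner ℝ (driftGradient b l η H g (n + (n - 1 - k)) (w k)) (ξ k)) +
      η * ∑ k ∈ range n, ‖r k‖ ^ 2 +
      η ^ 2 * ‖∑ k ∈ range n, sqrtPropagator b l η (n - 1 - k) (ξ k)‖ ^ 2 := by
  have hinner := fun m v u => inner_eq_sum_inner b (driftGradient b l η H g m v) u
  simp only [inner_eq_sum_inner b g, inner_eq_sum_inner b (w n), hinner, norm_sq_eq_sum_inner b]
  rw [sum_comm, sum_comm (s := range n) (t := univ), sum_comm (s := range n) (t := univ),
    sum_comm (s := range n) (t := univ)]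
  rw [mul_sum, mul_sum, mul_sum, mul_sum, ← sum_add_distrib, ← sum_add_distrib, mul_sum,
    ← sum_neg_distrib, ← sum_sub_distrib, ← sum_add_distrib, ← sum_add_distrib]
  refine sum_le_sum fun i _ => ?_
  have hrec := inner_recursion hH hw i
  have h0' : inner ℝ (b i) (w 0) = 0 := by rw [h0, inner_zero_right]
  simp only [inner_sum, driftGradient, sqrtPropagator, inner_diagOp, hH, inner_add_right]
  split_ifs with h
  · have := quadratic_le_of_pos (w := fun k => inner ℝ (b i) (w k))
      (r := fun k => inner ℝ (b i) (r k)) (ξ := fun k => inner ℝ (b i) (ξ k))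
      hη h.le (hl i) h0' hrec
    simp only [zero_mul, add_zero, mul_assoc, ← mul_sum, mul_pow, Real.sq_sqrt h.le, pow_add,
      mul_add, sum_add_distrib] at this ⊢
    linarith
  · have := quadratic_le_of_nonpos (w := fun k => inner ℝ (b i) (w k))
      (e := fun k => inner ℝ (b i) (r k) + inner ℝ (b i) (ξ k))
      (not_lt.1 h) h0' hrec
    simp only [zero_mul, zero_add, one_mul, sum_const_zero, mul_add, sum_add_distrib] at this ⊢
    have h1 : 0 ≤ η * ∑ k ∈ range n, inner ℝ (b i) (r k) ^ 2 :=
      mul_nonneg hη (sum_nonneg fun _ _ => sq_nonneg _)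
    have h2 : 0 ≤ η * ∑ k ∈ range n, (inner ℝ (b i) g + l i * inner ℝ (b i) (w k)) ^ 2 :=
      mul_nonneg hη (sum_nonneg fun _ _ => sq_nonneg _)
    linarith

end Quadratic

end

noncomputable section

/-! ### Consequences of the parameter setting -/

section Parameters

/-- The logarithmic factor `log (48 K₀ / p)`. -/
def paramLog (d : ℕ) (ρ ε p η : ℝ) : ℝ := Real.log (48 * paramK d ρ ε p η / p)

/-- The smallness conditions under which a round of `n` steps of size `η` is analysed. -/
structure RoundBounds (L ρ σ η B Λ : ℝ) (n : ℕ) : Prop where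
  drift_le : η * n * (ρ * B ^ 2) ≤ B / 15
  noise_le : η ^ 2 * (4 * (n * σ ^ 2) * Λ) ≤ (B / 20) ^ 2
  curvature_le : η * (4 * (σ ^ 2 * (1 + Real.log n)) * Λ) ≤ ρ * B ^ 3 / 16
  cross_le : η * (4 * σ ^ 2 * Λ) ≤ ρ * B ^ 3 / 48
  smooth_le : η * L ≤ 1 / 1000
  step_le : η * σ ≤ B / 1000

variable {d : ℕ} {L ρ σ ε p η : ℝ}

namespace ParameterSetting

theorem delta_pos (h : ParameterSetting d L ρ σ ε p η) : 0 < paramDelta ρ ε :=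
  Real.sqrt_pos.2 (mul_pos h.rho_pos h.eps_pos)

theorem C_pos (h : ParameterSetting d L ρ σ ε p η) : 0 < paramC d p η := by
  have hK := h.one_le_K
  have h1 := h.delta_pos
  have h2 := h.eta_pos
  by_contra hC
  have : paramK d ρ ε p η ≤ 0 := by
    rw [paramK, paramDelta₂, mul_assoc]
    exact mul_nonpos_of_nonpos_of_nonneg (not_lt.1 hC) (by positivity)
  linarith

theorem K_mul (h : ParameterSetting d L ρ σ ε p η) :
    16 * η * paramDelta ρ ε * paramK d ρ ε p η = paramC d p η := by
  have h1 := h.delta_pos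
  have h2 := h.eta_pos
  rw [paramK, paramDelta₂]
  field_simp

theorem rho_mul_B_mul_C (h : ParameterSetting d L ρ σ ε p η) :
    ρ * paramB d ρ ε p η * paramC d p η = paramDelta ρ ε := by
  have h1 := h.C_pos
  have h2 := h.rho_pos
  rw [paramB]
  field_simp

theorem B_pos (h : ParameterSetting d L ρ σ ε p η) : 0 < paramB d ρ ε p η :=
  div_pos h.delta_pos (mul_pos h.rho_pos h.C_pos)

theorem three_le_log (h : ParameterSetting d L ρ σ ε p η) : 3 ≤ paramLog d ρ ε p η := by
  have hK := h.one_le_K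
  have hp := h.p_pos
  have hp1 := h.p_lt_one
  rw [paramLog, Real.le_log_iff_exp_le (by positivity)]
  have h1 : Real.exp 3 ≤ 48 := by
    have h3 : Real.exp 3 = Real.exp 1 ^ 3 := by rw [← Real.exp_nat_mul]; norm_num
    rw [h3]
    calc Real.exp 1 ^ 3 ≤ 3 ^ 3 :=
          pow_le_pow_left₀ (Real.exp_pos 1).le (by linarith [Real.exp_one_lt_d9]) 3
      _ ≤ 48 := by norm_num
  refine h1.trans ?_
  rw [le_div_iff₀ hp]
  nlinarith

/-- Substituting δ = ρBC̃₁ bounds the step size in terms of ρB³, the unit in which all errors are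
measured. -/
theorem eta_mul_le (h : ParameterSetting d L ρ σ ε p η) :
    64 * (η * max (σ ^ 2) 1 * paramLog d ρ ε p η * (3 + Real.log (paramK d ρ ε p η))) ≤
      ρ * paramB d ρ ε p η ^ 3 := by
  have h1 := h.eta_le
  have hC := h.C_pos
  have hΛ := h.three_le_log
  have hK := Real.log_nonneg h.one_le_K
  have hm : 1 ≤ max (σ ^ 2) 1 := le_max_right _ _
  rw [← paramLog, ← mul_div_assoc, mul_one, div_div, le_div_iff₀ (by positivity),
    ← h.rho_mul_B_mul_C] at h1
  refine le_of_mul_le_mul_right ?_ hC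
  linarith

/-- C̃₁ depends on log(1/η), while the bound on η involves C̃₁. The circle is broken by K₀ ≥ 1, that
is 16ηδ ≤ C̃₁: with 576η ≤ ρB³ and ρB³C̃₁ ≤ δ it gives 9216η² ≤ 1. -/
theorem two_le_C (h : ParameterSetting d L ρ σ ε p η) : 2 ≤ paramC d p η := by
  have hC := h.C_pos
  have hη := h.eta_pos
  have hp := h.p_pos
  have hd : 1 ≤ √(d : ℝ) := by
    rw [Real.one_le_sqrt, Nat.one_le_cast, Nat.one_le_iff_ne_zero]
    -- For d = 0 the convention log 0 = 0 would make C̃₁ vanish.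
    rintro rfl
    simp [paramC] at hC
  have hη1 : η ≤ 1 / 8 := by
    have h1 := h.eta_mul_le
    have hB1 : paramB d ρ ε p η ≤ 1 := h.B_le.trans (min_le_left _ _)
    have hB := h.B_pos
    have hδ := h.delta_pos
    have hK := h.one_le_K
    have h2 : 16 * η * paramDelta ρ ε ≤ paramC d p η := by
      rw [← h.K_mul]
      exact le_mul_of_one_le_right (by positivity) hK
    have h3 : η * 9 ≤ η * max (σ ^ 2) 1 * paramLog d ρ ε p η *
        (3 + Real.log (paramK d ρ ε p η)) := by
      have hm : 1 ≤ max (σ ^ 2) 1 := le_max_right _ _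
      have hΛ := h.three_le_log
      have hlog := Real.log_nonneg hK
      calc η * 9 = η * 1 * 3 * 3 := by ring
        _ ≤ _ := by gcongr; linarith
    have h4 : ρ * paramB d ρ ε p η ^ 3 * paramC d p η ≤ paramDelta ρ ε := by
      calc ρ * paramB d ρ ε p η ^ 3 * paramC d p η
          = ρ * paramB d ρ ε p η * paramC d p η * paramB d ρ ε p η ^ 2 := by ring
        _ ≤ paramDelta ρ ε := by
          rw [h.rho_mul_B_mul_C]
          exact mul_le_of_le_one_right hδ.le (pow_le_one₀ hB.le hB1)
    have h5 : η * 576 * (16 * η * paramDelta ρ ε) ≤ paramDelta ρ ε := by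
      refine le_trans ?_ h4
      exact mul_le_mul (by linarith) h2 (by positivity) (by have := h.rho_pos; positivity)
    have h6 : 9216 * η ^ 2 ≤ 1 := by
      refine le_of_mul_le_mul_right ?_ hδ
      linarith
    nlinarith
  have hlog : 1 ≤ Real.log (24 * √(d : ℝ) / η) := by
    rw [Real.le_log_iff_exp_le (by positivity), le_div_iff₀ hη]
    nlinarith [Real.exp_one_lt_d9, Real.exp_pos 1]
  have hfloor : (1 : ℝ) ≤ (⌊Real.log (3 * p⁻¹) / Real.log ((0.7 : ℝ)⁻¹) + 1⌋ : ℝ) := by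
    have h1 : (1 : ℤ) ≤ ⌊Real.log (3 * p⁻¹) / Real.log ((0.7 : ℝ)⁻¹) + 1⌋ := by
      rw [Int.le_floor]
      have h2 : 0 ≤ Real.log (3 * p⁻¹) := Real.log_nonneg (by
        have := (one_lt_inv₀ hp).2 h.p_lt_one
        linarith)
      have h3 : 0 ≤ Real.log ((0.7 : ℝ)⁻¹) := Real.log_nonneg (by norm_num)
      push_cast
      linarith [div_nonneg h2 h3]
    exact_mod_cast h1
  rw [paramC]
  nlinarith

theorem eta_mul_max_le (h : ParameterSetting d L ρ σ ε p η) :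
    η * max (σ ^ 2) 1 ≤ paramB d ρ ε p η ^ 2 / 1152 := by
  have h1 := h.eta_mul_le
  have hη := h.eta_pos
  have hB := h.B_pos
  have hm : 1 ≤ max (σ ^ 2) 1 := le_max_right _ _
  have hΛ := h.three_le_log
  have hlog := Real.log_nonneg h.one_le_K
  have h2 : η * max (σ ^ 2) 1 * 9 ≤ η * max (σ ^ 2) 1 * paramLog d ρ ε p η *
      (3 + Real.log (paramK d ρ ε p η)) := by
    calc η * max (σ ^ 2) 1 * 9 = η * max (σ ^ 2) 1 * 3 * 3 := by ring
      _ ≤ _ := by gcongr; linarith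
  have h3 : ρ * paramB d ρ ε p η * 2 ≤ 1 := by
    calc ρ * paramB d ρ ε p η * 2 ≤ ρ * paramB d ρ ε p η * paramC d p η :=
          mul_le_mul_of_nonneg_left h.two_le_C (mul_pos h.rho_pos hB).le
      _ ≤ 1 := h.rho_mul_B_mul_C.le.trans h.delta_le
  have h4 : ρ * paramB d ρ ε p η ^ 3 ≤ paramB d ρ ε p η ^ 2 / 2 := by
    nlinarith [sq_nonneg (paramB d ρ ε p η)]
  linarith

theorem eta_le_one_div (h : ParameterSetting d L ρ σ ε p η) : η ≤ 1 / 1152 := by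
  have h1 := h.eta_mul_max_le
  have hm : 1 ≤ max (σ ^ 2) 1 := le_max_right _ _
  have hB1 : paramB d ρ ε p η ^ 2 ≤ 1 :=
    pow_le_one₀ h.B_pos.le (h.B_le.trans (min_le_left _ _))
  nlinarith [h.eta_pos]

theorem le_K (h : ParameterSetting d L ρ σ ε p η) : 144 ≤ paramK d ρ ε p η := by
  have h1 := h.K_mul
  have hC := h.two_le_C
  have hη := h.eta_le_one_div
  have h2 : η * paramDelta ρ ε ≤ 1 / 1152 * 1 :=
    mul_le_mul hη h.delta_le h.delta_pos.le (by norm_num)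
  have hK := h.one_le_K
  nlinarith

theorem L_mul_B_le (h : ParameterSetting d L ρ σ ε p η) : L * paramB d ρ ε p η ≤ σ := by
  have := h.B_le.trans ((min_le_right _ _).trans (min_le_left _ _))
  rwa [le_div_iff₀ h.L_pos, mul_comm] at this

theorem roundBounds (h : ParameterSetting d L ρ σ ε p η) {n : ℕ} (hn : 1 ≤ n)
    (hnK : n ≤ ⌈paramK d ρ ε p η⌉₊) :
    RoundBounds L ρ σ η (paramB d ρ ε p η) (paramLog d ρ ε p η) n := by
  have hη := h.eta_pos
  have hB := h.B_pos
  have hρ := h.rho_pos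
  have hK := h.le_K
  have hδ := h.delta_pos
  have hΛ := h.three_le_log
  have hmain := h.eta_mul_le
  have hmax := h.eta_mul_max_le
  have hB1 : paramB d ρ ε p η ≤ 1 := h.B_le.trans (min_le_left _ _)
  -- As K₀ ≥ 144, rounding up costs at most the factor 145/144; this is covered by the gap between
  -- the 1/16 of `hdriftK` and the 1/15 of `hdrift`.
  have hn' : (n : ℝ) ≤ 145 / 144 * paramK d ρ ε p η := by
    have h1 : (n : ℝ) ≤ (⌈paramK d ρ ε p η⌉₊ : ℝ) := by exact_mod_cast hnK
    have h2 := Nat.ceil_lt_add_one (by linarith : 0 ≤ paramK d ρ ε p η)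
    linarith
  have hn0 : (1 : ℝ) ≤ n := by exact_mod_cast hn
  have hlogK := Real.log_nonneg h.one_le_K
  have hlog : Real.log n ≤ 1 + Real.log (paramK d ρ ε p η) := by
    have h1 : Real.log n ≤ Real.log (145 / 144 * paramK d ρ ε p η) :=
      Real.log_le_log (by linarith) hn'
    rw [Real.log_mul (by norm_num) (by linarith)] at h1
    linarith [Real.log_le_sub_one_of_pos (show (0 : ℝ) < 145 / 144 by norm_num)]
  have hdriftK : η * paramK d ρ ε p η * (ρ * paramB d ρ ε p η ^ 2) = paramB d ρ ε p η / 16 := by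
    have h1 := h.K_mul
    have h2 := h.rho_mul_B_mul_C
    have h3 : paramDelta ρ ε * (16 * η * paramK d ρ ε p η * (ρ * paramB d ρ ε p η)) =
        paramDelta ρ ε * 1 := by
      linear_combination h2 + (ρ * paramB d ρ ε p η) * h1
    have h4 := mul_left_cancel₀ hδ.ne' h3
    linear_combination paramB d ρ ε p η / 16 * h4
  have hdrift : η * n * (ρ * paramB d ρ ε p η ^ 2) ≤ paramB d ρ ε p η / 15 := by
    have h1 : η * n * (ρ * paramB d ρ ε p η ^ 2) ≤
        η * (145 / 144 * paramK d ρ ε p η) * (ρ * paramB d ρ ε p η ^ 2) := by gcongr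
    linarith
  have hσm : σ ^ 2 ≤ max (σ ^ 2) 1 := le_max_left _ _
  have hnoise : η * (σ ^ 2 * paramLog d ρ ε p η) * (3 + Real.log (paramK d ρ ε p η)) ≤
      ρ * paramB d ρ ε p η ^ 3 / 64 := by
    have h1 : η * (σ ^ 2 * paramLog d ρ ε p η) * (3 + Real.log (paramK d ρ ε p η)) ≤
        η * (max (σ ^ 2) 1 * paramLog d ρ ε p η) * (3 + Real.log (paramK d ρ ε p η)) := by
      gcongr
    linarith
  have hq : 0 ≤ η * (σ ^ 2 * paramLog d ρ ε p η) := by positivity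
  have hcross : η * (4 * σ ^ 2 * paramLog d ρ ε p η) ≤ ρ * paramB d ρ ε p η ^ 3 / 48 := by
    have := mul_nonneg hq hlogK
    nlinarith
  refine ⟨hdrift, ?_, ?_, hcross, ?_, ?_⟩
  · calc η ^ 2 * (4 * (n * σ ^ 2) * paramLog d ρ ε p η)
        = η * n * (η * (4 * σ ^ 2 * paramLog d ρ ε p η)) := by ring
      _ ≤ η * n * (ρ * paramB d ρ ε p η ^ 3 / 48) := by gcongr
      _ = η * n * (ρ * paramB d ρ ε p η ^ 2) * paramB d ρ ε p η / 48 := by ring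
      _ ≤ paramB d ρ ε p η / 15 * paramB d ρ ε p η / 48 := by gcongr
      _ ≤ (paramB d ρ ε p η / 20) ^ 2 := by nlinarith [sq_nonneg (paramB d ρ ε p η)]
  · calc η * (4 * (σ ^ 2 * (1 + Real.log n)) * paramLog d ρ ε p η)
        = 4 * (η * (σ ^ 2 * paramLog d ρ ε p η) * (1 + Real.log n)) := by ring
      _ ≤ 4 * (η * (σ ^ 2 * paramLog d ρ ε p η) * (3 + Real.log (paramK d ρ ε p η))) := by
          gcongr ?_ * (_ * ?_)
          linarith
      _ ≤ ρ * paramB d ρ ε p η ^ 3 / 16 := by linarith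
  · have h1 : paramB d ρ ε p η * L ≤ 1 := by
      have := h.B_le.trans ((min_le_right _ _).trans (min_le_right _ _))
      rwa [le_div_iff₀ h.L_pos] at this
    have hηB : η ≤ paramB d ρ ε p η ^ 2 / 1152 := by
      have hm : 1 ≤ max (σ ^ 2) 1 := le_max_right _ _
      nlinarith
    have hL := h.L_pos
    calc η * L ≤ paramB d ρ ε p η ^ 2 / 1152 * L := by gcongr
      _ = paramB d ρ ε p η / 1152 * (paramB d ρ ε p η * L) := by ring
      _ ≤ 1 / 1152 * 1 := by gcongr
      _ ≤ 1 / 1000 := by norm_num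
  · have hσ := h.sigma_pos
    have h1 : σ ≤ max (σ ^ 2) 1 := by
      rcases le_total σ 1 with h1 | h1
      · exact h1.trans (le_max_right _ _)
      · exact le_trans (by nlinarith) hσm
    calc η * σ ≤ η * max (σ ^ 2) 1 := by gcongr
      _ ≤ paramB d ρ ε p η ^ 2 / 1152 := hmax
      _ ≤ paramB d ρ ε p η / 1000 := by nlinarith

theorem decrease_eq (h : ParameterSetting d L ρ σ ε p η) :
    paramB d ρ ε p η ^ 2 / (7 * η * paramK d ρ ε p η) = 16 / 7 * (ρ * paramB d ρ ε p η ^ 3) := by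
  have hη := h.eta_pos
  have hK := h.le_K
  have h1 := h.K_mul
  have h2 := h.rho_mul_B_mul_C
  have hδ := h.delta_pos
  have h3 : paramDelta ρ ε * (16 * η * paramK d ρ ε p η * (ρ * paramB d ρ ε p η)) =
      paramDelta ρ ε * 1 := by
    linear_combination h2 + (ρ * paramB d ρ ε p η) * h1
  have h4 := mul_left_cancel₀ hδ.ne' h3
  rw [div_eq_iff (by positivity)]
  linear_combination -(paramB d ρ ε p η) ^ 2 * h4

theorem decrease_eq_rpow (h : ParameterSetting d L ρ σ ε p η) :
    paramB d ρ ε p η ^ 2 / (7 * η * paramK d ρ ε p η) =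
      16 / 7 * ε ^ (3 / 2 : ℝ) / (√ρ * paramC d p η ^ 3) := by
  have hC := h.C_pos
  have hρ := h.rho_pos
  have hε : ε ^ (3 / 2 : ℝ) = √ε ^ 3 := by
    rw [Real.sqrt_eq_rpow, ← Real.rpow_natCast, ← Real.rpow_mul h.eps_pos.le]
    norm_num
  have hs : 0 < √ρ := Real.sqrt_pos.2 hρ
  rw [h.decrease_eq, hε, paramB, paramDelta, Real.sqrt_mul hρ.le]
  have h2 : √ρ ^ 2 = ρ := Real.sq_sqrt hρ.le
  generalize √ρ = t at *
  subst h2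
  field_simp

/-- Each n costs 5 exp(-Λ) = 5p/(48K₀), so the union bound has ample room. -/
theorem failure_le (h : ParameterSetting d L ρ σ ε p η) :
    ⌈paramK d ρ ε p η⌉₊ * (5 * Real.exp (-paramLog d ρ ε p η)) ≤ 2 / 3 * p := by
  have hK := h.le_K
  have hp := h.p_pos
  have h2 := Nat.ceil_lt_add_one (by linarith : 0 ≤ paramK d ρ ε p η)
  rw [paramLog, Real.exp_neg, Real.exp_log (by positivity), inv_div, ← mul_div_assoc,
    ← mul_div_assoc, div_le_iff₀ (by positivity)]
  nlinarith

end ParameterSetting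

end Parameters

end

noncomputable section

/-! ### Decrease of the objective along a round that leaves the ball -/

section Descent

open Finset

/-- Of the 7/8 in `quadratic_le`, one eighth pays for the pairing with the remainders and one for
the variance of the pairing with the noise. Here c is the displacement left to the gradients. -/
theorem quadratic_le_of_displacement {E ι : Type*} [NormedAddCommGroup E] [InnerProductSpace ℝ E]
    [Fintype ι] {b : OrthonormalBasis ι ℝ E} {l : ι → ℝ} {η α γ τ c : ℝ} {H : E →L[ℝ] E} {g : E}
    {w r ξ : ℕ → E} {n : ℕ} (hη : 0 < η) (hn : 1 ≤ n) (hl : ∀ i, η * l i ≤ 1 / 4)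
    (hH : ∀ i v, inner ℝ (b i) (H v) = l i * inner ℝ (b i) v) (h0 : w 0 = 0)
    (hw : ∀ k < n, w (k + 1) = w k - η • (g + H (w k) + (r k + ξ k)))
    (hr : ∀ k < n, ‖r k‖ ≤ τ)
    (hα : ‖∑ k ∈ range n, propagator b l η (n - 1 - k) (ξ k)‖ ≤ α)
    (hγ : -∑ k ∈ range n, inner ℝ (driftGradient b l η H g (n + (n - 1 - k)) (w k)) (ξ k) ≤
      1 / 8 * ∑ k ∈ range n, ‖driftGradient b l η H g (n + (n - 1 - k)) (w k)‖ ^ 2 + γ)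
    (hc : 0 ≤ c) (hcw : c + η * n * τ + η * α ≤ ‖w n‖) :
    inner ℝ g (w n) + 1 / 2 * inner ℝ (w n) (H (w n)) ≤
      -(5 / 8 * (c ^ 2 / (η * n))) + η * γ + 3 * (η * n * τ ^ 2) +
      η ^ 2 * ‖∑ k ∈ range n, sqrtPropagator b l η (n - 1 - k) (ξ k)‖ ^ 2 := by
  have hl1 : ∀ i, η * l i ≤ 1 := fun i => (hl i).trans (by norm_num)
  have hn0 : (0 : ℝ) < n := by exact_mod_cast hn
  have hq := quadratic_le hη.le hl hH h0 hw
  have hd := displacement_eq hH h0 hw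
  set G : ℕ → E := fun k => driftGradient b l η H g k (w k) with hG
  set G' : ℕ → E := fun k => driftGradient b l η H g (n + (n - 1 - k)) (w k) with hG'
  have hGG : ∀ k ∈ range n, ‖G' k‖ ≤ ‖G k‖ := fun k hk =>
    norm_driftGradient_le hη.le hl1 (by have := mem_range.1 hk; omega) _
  have hsq : ∑ k ∈ range n, ‖G' k‖ ^ 2 ≤ ∑ k ∈ range n, ‖G k‖ ^ 2 :=
    sum_le_sum fun k hk => pow_le_pow_left₀ (norm_nonneg _) (hGG k hk) 2
  have hrsq : ∑ k ∈ range n, ‖r k‖ ^ 2 ≤ n * τ ^ 2 := by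
    have := sum_le_card_nsmul (range n) (fun k => ‖r k‖ ^ 2) (τ ^ 2) fun k hk =>
      pow_le_pow_left₀ (norm_nonneg _) (hr k (mem_range.1 hk)) 2
    simpa using this
  have hcross : -∑ k ∈ range n, inner ℝ (G' k) (r k) ≤
      1 / 8 * ∑ k ∈ range n, ‖G k‖ ^ 2 + 2 * ∑ k ∈ range n, ‖r k‖ ^ 2 := by
    rw [← sum_neg_distrib, mul_sum, mul_sum, ← sum_add_distrib]
    refine sum_le_sum fun k hk => ?_
    have h1 := (neg_le_abs _).trans (abs_real_inner_le_norm (G' k) (r k))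
    have h2 := mul_le_mul_of_nonneg_right (hGG k hk) (norm_nonneg (r k))
    nlinarith [sq_nonneg (‖G k‖ - 4 * ‖r k‖)]
  have hdist : c ≤ η * ∑ k ∈ range n, ‖G k‖ := by
    have h1 : ‖w n‖ ≤ η * ∑ k ∈ range n, ‖G k‖ + η * (n * τ + α) := by
      rw [hd]
      refine (norm_sub_le _ _).trans (add_le_add ?_ ?_)
      · rw [norm_neg, norm_smul, Real.norm_of_nonneg hη.le]
        exact mul_le_mul_of_nonneg_left (norm_sum_le _ _) hη.le
      · rw [norm_smul, Real.norm_of_nonneg hη.le]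
        refine mul_le_mul_of_nonneg_left ((norm_add_le _ _).trans (add_le_add ?_ hα)) hη.le
        refine (norm_sum_le _ _).trans ?_
        have := sum_le_card_nsmul (range n) (fun k => ‖propagator b l η (n - 1 - k) (r k)‖) τ
          fun k hk => ((norm_propagator_le hη.le hl1 _ _).trans (one_mul _).le).trans
            (hr k (mem_range.1 hk))
        simpa using this
    linarith
  have hcs := sq_sum_le_card_mul_sum_sq (s := range n) (f := fun k => ‖G k‖)
  rw [card_range] at hcs
  have hc2 : c ^ 2 / (η * n) ≤ η * ∑ k ∈ range n, ‖G k‖ ^ 2 := by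
    rw [div_le_iff₀ (by positivity)]
    calc c ^ 2 ≤ (η * ∑ k ∈ range n, ‖G k‖) ^ 2 := pow_le_pow_left₀ hc hdist 2
      _ = η ^ 2 * (∑ k ∈ range n, ‖G k‖) ^ 2 := by ring
      _ ≤ η ^ 2 * (n * ∑ k ∈ range n, ‖G k‖ ^ 2) := by gcongr
      _ = _ := by ring
  have e1 := mul_le_mul_of_nonneg_left hγ hη.le
  have e2 := mul_le_mul_of_nonneg_left hcross hη.le
  have e3 := mul_le_mul_of_nonneg_left hsq hη.le
  have e4 := mul_le_mul_of_nonneg_left hrsq hη.le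
  linarith

variable {d : ℕ} {f : EuclideanSpace ℝ (Fin d) → ℝ} {L ρ σ η B Λ : ℝ} {n : ℕ}
  {x ξ : ℕ → EuclideanSpace ℝ (Fin d)}

/-- Before the exit the gradient exceeds 5σ - LB ≥ 4σ, so the noise is at most a quarter of it and
every step is a descent step. -/
theorem decrease_of_large_gradient (hL : 0 ≤ L) (hη : 0 < η)
    (hρ : 0 ≤ ρ) (hB : 0 < B)
    (hLB : L * B ≤ σ) (hR : RoundBounds L ρ σ η B Λ n) (hn : 1 ≤ n) (hf : ContDiff ℝ 2 f)
    (hlip : ∀ x y, ‖gradient f x - gradient f y‖ ≤ L * ‖x - y‖)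
    (hx : ∀ k, x (k + 1) = x k - η • (gradient f (x k) + ξ k)) (hξ : ∀ k, ‖ξ k‖ ≤ σ)
    (hin : ∀ k < n, ‖x k - x 0‖ ≤ B) (hout : B < ‖x n - x 0‖)
    (hg : 5 * σ < ‖gradient f (x 0)‖) :
    f (x n) ≤ f (x 0) - 16 / 7 * (ρ * B ^ 3) := by
  have hn0 : (0 : ℝ) < n := by exact_mod_cast hn
  have hgk : ∀ k < n, ‖ξ k‖ ≤ 1 / 4 * ‖gradient f (x k)‖ := by
    intro k hk
    have h1 := hlip (x 0) (x k)
    have h2 : L * ‖x 0 - x k‖ ≤ L * B := by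
      rw [norm_sub_rev]; exact mul_le_mul_of_nonneg_left (hin k hk) hL
    have h3 := norm_sub_norm_le (gradient f (x 0)) (gradient f (x k))
    linarith [hξ k]
  have hstep : ∀ k < n, ‖gradient f (x k) + ξ k‖ ≤ 5 / 4 * ‖gradient f (x k)‖ := fun k hk => by
    linarith [norm_add_le (gradient f (x k)) (ξ k), hgk k hk]
  have hdec : ∀ m ≤ n, f (x m) ≤
      f (x 0) - 7 / 10 * η * ∑ k ∈ range m, ‖gradient f (x k)‖ ^ 2 := by
    intro m
    induction m with
    | zero => simp
    | succ m ih =>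
      intro hm
      have ih := ih (by omega)
      have h1 := le_add_inner_add_norm_sq hL hf hlip (x m) (x (m + 1))
      rw [sum_range_succ]
      have hΔ : x (m + 1) - x m = -(η • (gradient f (x m) + ξ m)) := by rw [hx]; abel
      rw [hΔ, norm_neg, inner_neg_right, inner_smul_right, inner_add_right,
        real_inner_self_eq_norm_sq, norm_smul, Real.norm_of_nonneg hη.le] at h1
      have h2 := (neg_le_abs _).trans (abs_real_inner_le_norm (gradient f (x m)) (ξ m))
      have h3 := mul_le_mul_of_nonneg_left (hgk m (by omega)) (norm_nonneg (gradient f (x m)))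
      have h4 := pow_le_pow_left₀ (norm_nonneg _) (hstep m (by omega)) 2
      have h5 : L * (η * ‖gradient f (x m) + ξ m‖) ^ 2 ≤
          η * (1 / 1000 * (5 / 4 * ‖gradient f (x m)‖) ^ 2) := by
        calc L * (η * ‖gradient f (x m) + ξ m‖) ^ 2
            = η * ((η * L) * ‖gradient f (x m) + ξ m‖ ^ 2) := by ring
          _ ≤ _ := by
            have := hR.smooth_le
            gcongr
      have h6 : η * (3 / 4 * ‖gradient f (x m)‖ ^ 2) ≤
          η * (‖gradient f (x m)‖ ^ 2 + inner ℝ (gradient f (x m)) (ξ m)) := by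
        gcongr; nlinarith
      nlinarith [mul_nonneg hη.le (sq_nonneg ‖gradient f (x m)‖)]
  have hdist : ∀ m ≤ n, ‖x m - x 0‖ ≤ 5 / 4 * η * ∑ k ∈ range m, ‖gradient f (x k)‖ := by
    intro m
    induction m with
    | zero => simp
    | succ m ih =>
      intro hm
      have ih := ih (by omega)
      rw [sum_range_succ, hx, sub_right_comm]
      have h1 := norm_sub_le (x m - x 0) (η • (gradient f (x m) + ξ m))
      rw [norm_smul, Real.norm_of_nonneg hη.le] at h1
      have h2 := mul_le_mul_of_nonneg_left (hstep m (by omega)) hη.le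
      linarith
  have h1 := hdec n le_rfl
  have h2 := hdist n le_rfl
  have hcs := sq_sum_le_card_mul_sum_sq (s := range n) (f := fun k => ‖gradient f (x k)‖)
  rw [card_range] at hcs
  have h3 : B ^ 2 ≤ η * n * (25 / 16 * (η * ∑ k ∈ range n, ‖gradient f (x k)‖ ^ 2)) := by
    calc B ^ 2 ≤ (5 / 4 * η * ∑ k ∈ range n, ‖gradient f (x k)‖) ^ 2 :=
          pow_le_pow_left₀ hB.le (by linarith) 2
      _ = 25 / 16 * η ^ 2 * (∑ k ∈ range n, ‖gradient f (x k)‖) ^ 2 := by ring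
      _ ≤ 25 / 16 * η ^ 2 * (n * ∑ k ∈ range n, ‖gradient f (x k)‖ ^ 2) := by gcongr
      _ = _ := by ring
  have h4 : η * n * (15 * (ρ * B ^ 3)) ≤ B ^ 2 := by
    have := mul_le_mul_of_nonneg_right hR.drift_le hB.le
    nlinarith
  have h5 := le_of_mul_le_mul_left (h4.trans h3) (mul_pos hη hn0)
  have h6 : 0 ≤ ρ * B ^ 3 := by positivity
  linarith

theorem decrease_of_small_gradient {ι : Type*} [Fintype ι]
    {b : OrthonormalBasis ι ℝ (EuclideanSpace ℝ (Fin d))}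
    {l : ι → ℝ} (hL : 0 ≤ L) (hη : 0 < η) (hρ : 0 ≤ ρ) (hB : 0 < B)
    (hLB : L * B ≤ σ) (hR : RoundBounds L ρ σ η B Λ n) (hn : 1 ≤ n) (hf : ContDiff ℝ 2 f)
    (hlip : ∀ x y, ‖gradient f x - gradient f y‖ ≤ L * ‖x - y‖)
    (hhess : ∀ x y, ‖hessian f x - hessian f y‖ ≤ ρ * ‖x - y‖)
    (hlL : ∀ i, l i ≤ L)
    (hH : ∀ i v, inner ℝ (b i) (hessian f (x 0) v) = l i * inner ℝ (b i) v)
    (hx : ∀ k, x (k + 1) = x k - η • (gradient f (x k) + ξ k)) (hξ : ∀ k, ‖ξ k‖ ≤ σ)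
    (hin : ∀ k < n, ‖x k - x 0‖ ≤ B) (hout : B < ‖x n - x 0‖)
    (hg : ‖gradient f (x 0)‖ ≤ 5 * σ)
    (hα : ‖∑ k ∈ range n, propagator b l η (n - 1 - k) (ξ k)‖ ^ 2 ≤ 4 * (n * σ ^ 2) * Λ)
    (hβ : ‖∑ k ∈ range n, sqrtPropagator b l η (n - 1 - k) (ξ k)‖ ^ 2 ≤
      4 * (σ ^ 2 * (1 + Real.log n) / η) * Λ)
    (hγ : -∑ k ∈ range n, inner ℝ (driftGradient b l η (hessian f (x 0)) (gradient f (x 0))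
        (n + (n - 1 - k)) (x k - x 0)) (ξ k) ≤
      1 / 8 * ∑ k ∈ range n, ‖driftGradient b l η (hessian f (x 0)) (gradient f (x 0))
        (n + (n - 1 - k)) (x k - x 0)‖ ^ 2 + 4 * σ ^ 2 * Λ) :
    f (x n) ≤ f (x 0) - 16 / 7 * (ρ * B ^ 3) := by
  have hn0 : (0 : ℝ) < n := by exact_mod_cast hn
  have hηl : ∀ i, η * l i ≤ 1 / 4 := fun i => by
    have := mul_le_mul_of_nonneg_left (hlL i) hη.le
    linarith [hR.smooth_le]
  have hα' : η * ‖∑ k ∈ range n, propagator b l η (n - 1 - k) (ξ k)‖ ≤ B / 20 := by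
    rw [← sq_le_sq₀ (by positivity) (by positivity), mul_pow]
    exact (mul_le_mul_of_nonneg_left hα (sq_nonneg _)).trans hR.noise_le
  have hq := quadratic_le_of_displacement (b := b) (l := l) (H := hessian f (x 0))
    (g := gradient f (x 0)) (w := fun k => x k - x 0)
    (r := fun k => gradient f (x k) - gradient f (x 0) - hessian f (x 0) (x k - x 0))
    -- Remainders take B/15 and noise B/20, and 22/25 ≤ 1 - 1/15 - 1/20.
    (ξ := ξ) (τ := ρ * B ^ 2) (c := 22 / 25 * B) hη hn hηl hH (sub_self _)
    (fun k _ => by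
      simp only [hx]
      module)
    (fun k hk => norm_gradient_sub_hessian_le hρ hf hhess _ _ (hin k hk)) le_rfl hγ
    (by positivity) (by have := hR.drift_le; linarith)
  -- The last step may overshoot the sphere. It has length at most 7ησ because the gradient at x⁰ is
  -- small.
  have hxn : ‖x n - x 0‖ ≤ 11 / 10 * B := by
    obtain ⟨m, rfl⟩ : ∃ m, n = m + 1 := ⟨n - 1, by omega⟩
    have hm := hin m (by omega)
    rw [hx, sub_right_comm]
    refine (norm_sub_le _ _).trans ?_
    rw [norm_smul, Real.norm_of_nonneg hη.le]
    have h1 : ‖gradient f (x m)‖ ≤ 6 * σ := by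
      have h2 := hlip (x m) (x 0)
      have h3 := mul_le_mul_of_nonneg_left hm hL
      have h4 := norm_sub_norm_le (gradient f (x m)) (gradient f (x 0))
      linarith
    have h5 : η * ‖gradient f (x m) + ξ m‖ ≤ η * (7 * σ) := by
      gcongr
      linarith [norm_add_le (gradient f (x m)) (ξ m), hξ m]
    linarith [hR.step_le]
  have hT := le_add_inner_add_hessian hρ hf hhess (x 0) (x n) hxn
  have h15 : 15 * (ρ * B ^ 3) ≤ B ^ 2 / (η * n) := by
    rw [le_div_iff₀ (by positivity)]
    have := mul_le_mul_of_nonneg_right hR.drift_le hB.le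
    nlinarith
  have hc : (22 / 25 * B) ^ 2 / (η * n) = 484 / 625 * (B ^ 2 / (η * n)) := by ring
  have hτ : η * n * (ρ * B ^ 2) ^ 2 ≤ ρ * B ^ 3 / 15 := by
    have := mul_le_mul_of_nonneg_right hR.drift_le (show 0 ≤ ρ * B ^ 2 by positivity)
    nlinarith
  have hβ' : η ^ 2 * ‖∑ k ∈ range n, sqrtPropagator b l η (n - 1 - k) (ξ k)‖ ^ 2 ≤
      ρ * B ^ 3 / 16 := by
    refine (mul_le_mul_of_nonneg_left hβ (sq_nonneg _)).trans (le_trans (le_of_eq ?_)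
      hR.curvature_le)
    field_simp
  have hU : 0 ≤ ρ * B ^ 3 := by positivity
  have := hR.cross_le
  rw [hc] at hq
  -- In units of ρB³ the decrease is at least 5/8 · 484/625 · 15 = 7.26. The losses are 1.331
  -- (Taylor at radius 11B/10), 3/15, 1/16 and 1/48, which leaves more than 16/7.
  nlinarith

end Descent

end

noncomputable section

/-! ### The round of stochastic gradient descent -/

section Round

open Finset

variable {d : ℕ}

/-- At step `n` the path `x` leaves the ball of radius `B` for the first time, and there the
objective exceeds `f (x 0) - T`. -/
def ExitsWithoutDecrease (f : EuclideanSpace ℝ (Fin d) → ℝ) (B T : ℝ) (n : ℕ)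
    (x : ℕ → EuclideanSpace ℝ (Fin d)) : Prop :=
  (∀ k < n, ‖x k - x 0‖ ≤ B) ∧ B < ‖x n - x 0‖ ∧ f (x 0) - T < f (x n)

theorem exists_eigenbasis {H : EuclideanSpace ℝ (Fin d) →L[ℝ] EuclideanSpace ℝ (Fin d)} {L : ℝ}
    (hsymm : ∀ u v, inner ℝ (H u) v = inner ℝ u (H v)) (hHL : ‖H‖ ≤ L) :
    ∃ (b : OrthonormalBasis (Fin d) ℝ (EuclideanSpace ℝ (Fin d))) (l : Fin d → ℝ),
      (∀ i, l i ≤ L) ∧ ∀ i v, inner ℝ (b i) (H v) = l i * inner ℝ (b i) v := by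
  have hs : (H : EuclideanSpace ℝ (Fin d) →ₗ[ℝ] EuclideanSpace ℝ (Fin d)).IsSymmetric := hsymm
  have hd : Module.finrank ℝ (EuclideanSpace ℝ (Fin d)) = d := finrank_euclideanSpace_fin
  have happ : ∀ i, H (hs.eigenvectorBasis hd i) =
      hs.eigenvalues hd i • hs.eigenvectorBasis hd i := fun i =>
    hs.apply_eigenvectorBasis hd i
  refine ⟨hs.eigenvectorBasis hd, hs.eigenvalues hd, fun i => ?_, fun i v => ?_⟩
  · have h1 := H.le_opNorm (hs.eigenvectorBasis hd i)
    rw [happ, norm_smul, (hs.eigenvectorBasis hd).norm_eq_one, mul_one, mul_one] at h1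
    exact (Real.le_norm_self _).trans (h1.trans hHL)
  · rw [← hsymm, happ, real_inner_smul_left]

/-- A harmonic sum; it accounts for log K₀ in the step size condition. -/
theorem sum_sqrt_mul_sq_le {η σ : ℝ} (hη : 0 < η) (n : ℕ) :
    ∑ j ∈ range n, (√(1 / (η * ((n - 1 - j : ℕ) + 1))) * σ) ^ 2 ≤
      σ ^ 2 * (1 + Real.log n) / η := by
  have h1 : ∀ m : ℕ, (√(1 / (η * ((m : ℝ) + 1))) * σ) ^ 2 = σ ^ 2 / η * ((m : ℝ) + 1)⁻¹ := by
    intro m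
    rw [mul_pow, Real.sq_sqrt (by positivity)]
    field_simp
  rw [sum_range_reflect (fun m => (√(1 / (η * ((m : ℝ) + 1))) * σ) ^ 2) n]
  simp_rw [h1]
  rw [← mul_sum, mul_div_right_comm]
  refine mul_le_mul_of_nonneg_left ?_ (by positivity)
  have := harmonic_le_one_add_log n
  simpa [harmonic] using this

variable {Z Ω : Type*} [MeasurableSpace Z] [MeasurableSpace Ω] {D : Measure Z}
  [IsProbabilityMeasure D] {μ : Measure Ω} [IsProbabilityMeasure μ]
  {F : EuclideanSpace ℝ (Fin d) → Z → ℝ} {L ρ σ ε p η : ℝ}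

theorem measurable_sgdIterate
    (hF : Measurable fun q : EuclideanSpace ℝ (Fin d) × Z => stochGrad F q.1 q.2) (k : ℕ) :
    Measurable fun q : EuclideanSpace ℝ (Fin d) × (ℕ → Z) => sgdIterate F η q.1 q.2 k := by
  induction k with
  | zero => exact measurable_fst
  | succ k ih =>
    exact ih.sub ((hF.comp (ih.prodMk ((measurable_pi_apply k).comp measurable_snd))).const_smul η)

theorem measurableSet_exitsWithoutDecrease
    (hF : Measurable fun q : EuclideanSpace ℝ (Fin d) × Z => stochGrad F q.1 q.2)
    {f : EuclideanSpace ℝ (Fin d) → ℝ} (hf : Measurable f) (B T : ℝ) (n : ℕ) :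
    MeasurableSet {q : EuclideanSpace ℝ (Fin d) × (ℕ → Z) |
      ExitsWithoutDecrease f B T n (sgdIterate F η q.1 q.2)} := by
  have hx := fun k => measurable_sgdIterate (η := η) hF k
  have hnorm := fun k => ((hx k).sub (hx 0)).norm
  have h1 : MeasurableSet {q : EuclideanSpace ℝ (Fin d) × (ℕ → Z) |
      ∀ k < n, ‖sgdIterate F η q.1 q.2 k - sgdIterate F η q.1 q.2 0‖ ≤ B} := by
    simp only [Set.ofPred_forall]
    exact MeasurableSet.iInter fun k => MeasurableSet.iInter fun _ =>
      measurableSet_le (hnorm k) measurable_const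
  exact h1.inter ((measurableSet_lt measurable_const (hnorm n)).inter
    (measurableSet_lt ((hf.comp (hx 0)).sub_const T) (hf.comp (hx n))))

theorem meas_exitsWithoutDecrease_le (hpar : ParameterSetting d L ρ σ ε p η)
    (hF : Measurable fun q : EuclideanSpace ℝ (Fin d) × Z => stochGrad F q.1 q.2)
    (hint : ∀ x, Integrable (stochGrad F x) D)
    (hmean : ∀ x, ∫ z, stochGrad F x z ∂D = gradient (objective F D) x)
    (hlip : ∀ x y, ‖gradient (objective F D) x - gradient (objective F D) y‖ ≤ L * ‖x - y‖)
    (hf : ContDiff ℝ 2 (objective F D))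
    (hhess : ∀ x y,
      ‖hessian (objective F D) x - hessian (objective F D) y‖ ≤ ρ * ‖x - y‖)
    (hnoise : ∀ x, ∀ᵐ z ∂D, ‖stochGrad F x z - gradient (objective F D) x‖ ^ 2 ≤ σ ^ 2)
    {ζ : ℕ → Ω → Z} (hζ : ∀ k, Measurable (ζ k)) (hlaw : ∀ k, μ.map (ζ k) = D)
    (hindep : iIndepFun ζ μ) (x₀ : EuclideanSpace ℝ (Fin d)) {n : ℕ} (hn : 1 ≤ n)
    (hnK : n ≤ ⌈paramK d ρ ε p η⌉₊) :
    μ {ω | ExitsWithoutDecrease (objective F D) (paramB d ρ ε p η)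
        (16 / 7 * (ρ * paramB d ρ ε p η ^ 3)) n (sgdIterate F η x₀ fun j => ζ j ω)} ≤
      ENNReal.ofReal (5 * Real.exp (-paramLog d ρ ε p η)) := by
  have hR := hpar.roundBounds hn hnK
  have hL := hpar.L_pos.le
  have hσ := hpar.sigma_pos
  have hη := hpar.eta_pos
  have hn0 : (0 : ℝ) < n := by exact_mod_cast hn
  have hlogn : 0 ≤ Real.log n := Real.log_nonneg (by exact_mod_cast hn)
  set f := objective F D
  set B := paramB d ρ ε p η
  set Λ := paramLog d ρ ε p η
  set g := gradient f x₀ with hg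
  set H := hessian f x₀ with hH
  obtain ⟨b, l, hlL, hbl⟩ := exists_eigenbasis (inner_hessian_comm hf x₀)
    (norm_hessian_le hL hlip x₀)
  have hηl : ∀ i, η * l i ≤ 1 := fun i => by
    have := mul_le_mul_of_nonneg_left (hlL i) hη.le
    linarith [hR.smooth_le]
  have hgm : Measurable (gradient f) := (differentiable_gradient hf).continuous.measurable
  set step : EuclideanSpace ℝ (Fin d) × Z → EuclideanSpace ℝ (Fin d) :=
    fun q => q.1 - η • stochGrad F q.1 q.2 with hstepdef
  have hstep : Measurable step := measurable_fst.sub (hF.const_smul η)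
  set x : ℕ → Ω → EuclideanSpace ℝ (Fin d) :=
    fun k ω => sgdIterate F η x₀ (fun j => ζ j ω) k with hxdef
  have hx0 : ∀ ω, x 0 ω = x₀ := fun _ => rfl
  have hx : ∀ k ω, x (k + 1) ω = step (x k ω, ζ k ω) := fun _ _ => rfl
  set ξ : EuclideanSpace ℝ (Fin d) × Z → EuclideanSpace ℝ (Fin d) :=
    fun q => stochGrad F q.1 q.2 - gradient f q.1 with hξdef
  have hξ : Measurable ξ := hF.sub (hgm.comp measurable_fst)
  have hb : ∀ y, ∀ᵐ z ∂D, ‖ξ (y, z)‖ ≤ σ := fun y => by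
    filter_upwards [hnoise y] with z hz using norm_le_of_norm_sub_sq_le hσ.le hz
  have hξ0 : ∀ y, ∫ z, ξ (y, z) ∂D = 0 := fun y => by
    simp only [hξdef]
    rw [integral_sub (hint y) (integrable_const _), hmean]
    simp [f]
  have hae : ∀ᵐ ω ∂μ, ∀ k, ‖ξ (x k ω, ζ k ω)‖ ≤ σ := ae_all_iff.2 fun k =>
    ae_state_sample hζ hlaw hindep (step := fun _ => step) (fun _ => hstep) hx0 hx
      (P := fun q => ‖ξ q‖ ≤ σ) (measurableSet_le hξ.norm measurable_const) hb k
  have h1 := meas_norm_sq_sum_ge_le hζ hlaw hindep hstep hx0 hx hξ hσ.le hb hξ0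
    (A := fun j => propagator b l η (n - 1 - j)) (b := fun _ => 1) (fun _ => zero_le_one) (K := n)
    (fun j _ => norm_propagator_le hη.le hηl _) (V := n * σ ^ 2) (by positivity) (by simp) Λ
  have h2 := meas_norm_sq_sum_ge_le hζ hlaw hindep hstep hx0 hx hξ hσ.le hb hξ0
    (A := fun j => sqrtPropagator b l η (n - 1 - j))
    (b := fun j => √(1 / (η * ((n - 1 - j : ℕ) + 1)))) (fun _ => Real.sqrt_nonneg _) (K := n)
    (fun j _ => norm_sqrtPropagator_le hη hηl _) (V := σ ^ 2 * (1 + Real.log n) / η)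
    (by positivity) (sum_sqrt_mul_sq_le hη n) Λ
  have h3 := meas_sum_inner_ge_le hζ hlaw hindep hstep hx0 hx hξ hσ.le hb hξ0
    -- With the scale 1/(4σ²), multiplication by 4σ² turns the subtracted variance into 1/8 of the
    -- sum of squared gradients, as `decrease_of_small_gradient` requires.
    (a := fun j y => (-(1 / (4 * σ ^ 2)) : ℝ) • driftGradient b l η H g (n + (n - 1 - j)) (y - x₀))
    (fun j => by
      have hc : Continuous fun y : EuclideanSpace ℝ (Fin d) =>
          driftGradient b l η H g (n + (n - 1 - j)) (y - x₀) := by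
        unfold driftGradient
        fun_prop
      exact hc.measurable.const_smul (-(1 / (4 * σ ^ 2)) : ℝ)) n Λ
  set E1 := {ω | 4 * (n * σ ^ 2) * Λ ≤
    ‖∑ j ∈ range n, propagator b l η (n - 1 - j) (ξ (x j ω, ζ j ω))‖ ^ 2}
  set E2 := {ω | 4 * (σ ^ 2 * (1 + Real.log n) / η) * Λ ≤
    ‖∑ j ∈ range n, sqrtPropagator b l η (n - 1 - j) (ξ (x j ω, ζ j ω))‖ ^ 2}
  set E3 := {ω | Λ ≤ ∑ j ∈ range n, (inner ℝ (-(1 / (4 * σ ^ 2)) •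
    driftGradient b l η H g (n + (n - 1 - j)) (x j ω - x₀)) (ξ (x j ω, ζ j ω)) -
    σ ^ 2 * ‖-(1 / (4 * σ ^ 2)) • driftGradient b l η H g (n + (n - 1 - j)) (x j ω - x₀)‖ ^ 2
      / 2)} with hE3
  have hsub : ∀ᵐ ω ∂μ, ExitsWithoutDecrease f B (16 / 7 * (ρ * B ^ 3)) n
      (sgdIterate F η x₀ fun j => ζ j ω) → ω ∈ E1 ∪ E2 ∪ E3 := by
    filter_upwards [hae] with ω hω hbad
    obtain ⟨hin, hout, hgt⟩ := hbad
    by_contra hE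
    simp only [Set.mem_union, not_or] at hE
    obtain ⟨⟨hE1, hE2⟩, hE3'⟩ := hE
    have hrec : ∀ k, x (k + 1) ω = x k ω - η • (gradient f (x k ω) + ξ (x k ω, ζ k ω)) := by
      intro k
      rw [hx]
      simp only [hstepdef, hξdef]
      rw [add_sub_cancel]
    refine absurd hgt (not_lt.2 ?_)
    by_cases hlarge : 5 * σ < ‖g‖
    · exact decrease_of_large_gradient (x := fun k => x k ω) hL hη hpar.rho_pos.le
        hpar.B_pos hpar.L_mul_B_le hR hn hf hlip hrec hω hin hout hlarge
    · refine decrease_of_small_gradient (x := fun k => x k ω) (b := b) (l := l) hL hη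
        hpar.rho_pos.le hpar.B_pos hpar.L_mul_B_le hR hn hf hlip hhess hlL hbl hrec hω hin hout
        (not_lt.1 hlarge) (not_le.1 hE1).le (not_le.1 hE2).le ?_
      rw [hE3, Set.mem_ofPred_eq, not_le] at hE3'
      have h4 := hE3'.le
      simp only [inner_smul_left, norm_smul, mul_pow, sum_sub_distrib] at h4
      simp only [hx0]
      have e1 : ∀ y : ℝ, σ ^ 2 * (‖-(1 / (4 * σ ^ 2))‖ ^ 2 * y) / 2 = 1 / (32 * σ ^ 2) * y := by
        intro y
        rw [norm_neg, Real.norm_of_nonneg (by positivity)]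
        field_simp
        ring
      simp only [e1, ← mul_sum] at h4
      rw [sub_le_iff_le_add] at h4
      have h5 := mul_le_mul_of_nonneg_left h4 (by positivity : 0 ≤ 4 * σ ^ 2)
      simp only [map_neg, conj_trivial] at h5
      have e2 : ∀ y : ℝ, 4 * σ ^ 2 * (-(1 / (4 * σ ^ 2)) * y) = -y := by
        intro y; field_simp
      have e3 : ∀ y : ℝ, 4 * σ ^ 2 * (Λ + 1 / (32 * σ ^ 2) * y) = 1 / 8 * y + 4 * σ ^ 2 * Λ := by
        intro y; field_simp; ring
      rw [e2, e3] at h5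
      exact h5
  calc _ ≤ μ (E1 ∪ E2 ∪ E3) := measure_mono_ae hsub
    _ ≤ μ E1 + μ E2 + μ E3 := (measure_union_le _ _).trans (add_le_add (measure_union_le _ _) le_rfl)
    _ ≤ ENNReal.ofReal (2 * Real.exp (-Λ)) + ENNReal.ofReal (2 * Real.exp (-Λ)) +
        ENNReal.ofReal (Real.exp (-Λ)) := add_le_add (add_le_add h1 h2) h3
    _ = ENNReal.ofReal (5 * Real.exp (-Λ)) := by
      rw [← ENNReal.ofReal_add (by positivity) (by positivity),
        ← ENNReal.ofReal_add (by positivity) (by positivity)]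
      congr 1; ring

theorem exitTime_spec {x : ℕ → EuclideanSpace ℝ (Fin d)} {B : ℝ} (hB : 0 ≤ B) {k : ℕ}
    (hk : B < ‖x k - x 0‖) :
    1 ≤ exitTime x B ∧ exitTime x B ≤ k ∧ B < ‖x (exitTime x B) - x 0‖ ∧
      ∀ j < exitTime x B, ‖x j - x 0‖ ≤ B := by
  have hmem : B < ‖x (exitTime x B) - x 0‖ :=
    Nat.sInf_mem (s := {k | B < ‖x k - x 0‖}) ⟨k, hk⟩
  refine ⟨Nat.one_le_iff_ne_zero.2 fun h0 => ?_, Nat.sInf_le hk, hmem, fun j hj =>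
    not_lt.1 (Nat.notMem_of_lt_sInf hj)⟩
  rw [h0, sub_self, norm_zero] at hmem
  exact absurd hmem (not_lt.2 hB)

end Round

end

/-! ### Union over the exit step and random starting point -/

theorem mainTheorem4 {d : ℕ} {Z Ω : Type*} [MeasurableSpace Z] [MeasurableSpace Ω]
    (D : Measure Z) [IsProbabilityMeasure D]
    (μ : Measure Ω) [IsProbabilityMeasure μ]
    (F : EuclideanSpace ℝ (Fin d) → Z → ℝ)
    (L ρ σ ε p η : ℝ)
    (hpar : ParameterSetting d L ρ σ ε p η)
    -- the stochastic functions: measurable and integrable in `z`, differentiable in `x`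
    (hFmeas : ∀ x, Measurable (F x))
    (hFint : ∀ x, Integrable (F x) D)
    (hFdiff : ∀ z, Differentiable ℝ (fun x => F x z))
    -- smoothness: Lipschitz stochastic gradients and Lipschitz Hessian of the objective
    (hgrad : ∀ z x y, ‖stochGrad F x z - stochGrad F y z‖ ≤ L * ‖x - y‖)
    (hf : ContDiff ℝ 2 (objective F D))
    (hhess : ∀ x y,
      ‖hessian (objective F D) x - hessian (objective F D) y‖ ≤ ρ * ‖x - y‖)
    -- bounded noise
    (hnoise : ∀ x, ∀ᵐ z ∂D, ‖stochGrad F x z - gradient (objective F D) x‖ ^ 2 ≤ σ ^ 2)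
    -- i.i.d. samples with law `D`, independent of the (possibly random) starting point
    (ζ : ℕ → Ω → Z) (hζ : ∀ k, Measurable (ζ k))
    (hζlaw : ∀ k, μ.map (ζ k) = D)
    (hζindep : iIndepFun ζ μ)
    (x₀ : Ω → EuclideanSpace ℝ (Fin d)) (hx₀ : Measurable x₀)
    (hx₀indep : IndepFun x₀ (fun ω k => ζ k ω) μ) :
    ENNReal.ofReal (1 - 2 / 3 * p) ≤
      μ {ω | (∃ k : ℕ, k ≤ ⌈paramK d ρ ε p η⌉₊ ∧
              paramB d ρ ε p η <
                ‖sgdIterate F η (x₀ ω) (fun j => ζ j ω) k - x₀ ω‖) →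
            objective F D
                (sgdIterate F η (x₀ ω) (fun j => ζ j ω)
                  (exitTime (sgdIterate F η (x₀ ω) (fun j => ζ j ω)) (paramB d ρ ε p η))) ≤
              objective F D (x₀ ω) -
                paramB d ρ ε p η ^ 2 / (7 * η * paramK d ρ ε p η)} ∧
    paramB d ρ ε p η ^ 2 / (7 * η * paramK d ρ ε p η) =
      16 / 7 * ε ^ (3 / 2 : ℝ) / (√ρ * paramC d p η ^ 3) := by
  have hL := hpar.L_pos.le
  have hσ := hpar.sigma_pos.le
  have hF := measurable_uncurry_stochGrad hFmeas hFdiff hgrad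
  have hint := integrable_stochGrad hσ hFmeas hFdiff hnoise
  have hmean := integral_stochGrad hL hσ hFmeas hFint hFdiff hgrad hnoise
  have hlip := norm_gradient_objective_sub_le hint hmean hgrad
  refine ⟨?_, hpar.decrease_eq_rpow⟩
  rw [hpar.decrease_eq]
  set f := objective F D
  set B := paramB d ρ ε p η
  set N := ⌈paramK d ρ ε p η⌉₊
  set bad : Set (EuclideanSpace ℝ (Fin d) × (ℕ → Z)) := ⋃ n ∈ Finset.Icc 1 N,
    {q | ExitsWithoutDecrease f B (16 / 7 * (ρ * B ^ 3)) n (sgdIterate F η q.1 q.2)} with hbaddef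
  have hbad : MeasurableSet bad := (Finset.Icc 1 N).measurableSet_biUnion fun n _ =>
    measurableSet_exitsWithoutDecrease hF hf.continuous.measurable _ _ n
  have hζm : Measurable fun ω k => ζ k ω := measurable_pi_lambda _ hζ
  have hpair : Measurable fun ω => (x₀ ω, fun k => ζ k ω) := hx₀.prodMk hζm
  -- The eigenbasis of the Hessian depends on the starting point, so this point is frozen here and
  -- integrated out in `hprob` by independence.
  have hfix : ∀ y, μ {ω | (y, fun k => ζ k ω) ∈ bad} ≤ ENNReal.ofReal (2 / 3 * p) := by
    intro y
    calc μ {ω | (y, fun k => ζ k ω) ∈ bad}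
        ≤ μ (⋃ n ∈ Finset.Icc 1 N, {ω | ExitsWithoutDecrease f B (16 / 7 * (ρ * B ^ 3)) n
            (sgdIterate F η y fun j => ζ j ω)}) := by
          refine measure_mono fun ω hω => ?_
          simpa [hbaddef] using hω
      _ ≤ ∑ n ∈ Finset.Icc 1 N, μ {ω | ExitsWithoutDecrease f B (16 / 7 * (ρ * B ^ 3)) n
            (sgdIterate F η y fun j => ζ j ω)} := measure_biUnion_finset_le _ _
      _ ≤ ∑ n ∈ Finset.Icc 1 N, ENNReal.ofReal (5 * Real.exp (-paramLog d ρ ε p η)) :=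
          Finset.sum_le_sum fun n hn => meas_exitsWithoutDecrease_le hpar hF hint hmean hlip hf
            hhess hnoise hζ hζlaw hζindep y (Finset.mem_Icc.1 hn).1 (Finset.mem_Icc.1 hn).2
      _ = ENNReal.ofReal (N * (5 * Real.exp (-paramLog d ρ ε p η))) := by
          rw [Finset.sum_const, Nat.card_Icc, Nat.add_sub_cancel, nsmul_eq_mul,
            ENNReal.ofReal_mul N.cast_nonneg, ENNReal.ofReal_natCast]
      _ ≤ ENNReal.ofReal (2 / 3 * p) := ENNReal.ofReal_le_ofReal hpar.failure_le
  have hprob : μ {ω | (x₀ ω, fun k => ζ k ω) ∈ bad} ≤ ENNReal.ofReal (2 / 3 * p) := by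
    have : IsProbabilityMeasure (μ.map x₀) := Measure.isProbabilityMeasure_map hx₀.aemeasurable
    have : IsProbabilityMeasure (μ.map fun ω k => ζ k ω) :=
      Measure.isProbabilityMeasure_map hζm.aemeasurable
    calc μ {ω | (x₀ ω, fun k => ζ k ω) ∈ bad}
        = (μ.map fun ω => (x₀ ω, fun k => ζ k ω)) bad := (Measure.map_apply hpair hbad).symm
      _ = ∫⁻ y, (μ.map fun ω k => ζ k ω) (Prod.mk y ⁻¹' bad) ∂(μ.map x₀) := by
          rw [(indepFun_iff_map_prod_eq_prod_map_map hx₀.aemeasurable hζm.aemeasurable).1 hx₀indep,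
            Measure.prod_apply hbad]
      _ ≤ ∫⁻ _, ENNReal.ofReal (2 / 3 * p) ∂(μ.map x₀) := lintegral_mono fun y => by
          rw [Measure.map_apply hζm (measurable_prodMk_left hbad)]
          exact hfix y
      _ = ENNReal.ofReal (2 / 3 * p) := by simp
  calc ENNReal.ofReal (1 - 2 / 3 * p) = 1 - ENNReal.ofReal (2 / 3 * p) := by
        rw [ENNReal.ofReal_sub _ (by linarith [hpar.p_pos]), ENNReal.ofReal_one]
    _ ≤ 1 - μ {ω | (x₀ ω, fun k => ζ k ω) ∈ bad} := tsub_le_tsub_left hprob 1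
    _ = μ {ω | (x₀ ω, fun k => ζ k ω) ∈ bad}ᶜ := (prob_compl_eq_one_sub (hpair hbad)).symm
    _ ≤ _ := measure_mono fun ω hω => ?_
  rintro ⟨k, hkN, hk⟩
  obtain ⟨h1, h2, h3, h4⟩ := exitTime_spec (x := sgdIterate F η (x₀ ω) fun j => ζ j ω)
    hpar.B_pos.le hk
  by_contra hlt
  refine hω (Set.mem_biUnion (Finset.mem_coe.2 (Finset.mem_Icc.2 ⟨h1, h2.trans hkN⟩)) ?_)
  exact ⟨h4, h3, not_le.1 hlt⟩
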